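/- Let $M$ be an arbitrary first-order structure and let $G$ be a group that is interpretable in $M$ without parameters (for instance $\emptyset$-definable). Let $N=(M,X,\cdot)$ be the two-sorted structure consisting of $M$ with its original structure, a disjoint sort $X$, and a regular (free and transitive) action $\cdot\colon G\times X\to X$, $X\neq\emptyset$. Let $N^*=(M^*,X^*,\cdot)$ be a monster model extending $N$, i.e. an elementary extension that is $|T|^+$-saturated and strongly $|T|^+$-homogeneous, where $T=\mathrm{Th}(N)$. Let $G^*=G(M^*)$ be the group defined in $M^*$ by the formulas that define $G$, acting regularly on $X^*$, and let $x_0\in X^*$. For $f\in\mathrm{Aut}(M^*)$ and $g\in G^*$ let $\bar f,\bar g\in\mathrm{Aut}(N^*)$ be given by $$\bar f|_{M^*}=f,\quad \bar f(h\cdot x_0)=f(h)\cdot x_0,\qquad \bar g|_{M^*}=\mathrm{id},\quad \bar g(h\cdot x_0)=(hg^{-1})\cdot x_0\qquad(h\in G^*).$$ For a monster model $C$, let $\mathrm{Aut}(C/A)$ be the group of automorphisms of $C$ fixing $A$ pointwise, let $\mathrm{Autf}_L(C)$ be the subgroup of $\mathrm{Aut}(C)$ generated by all $\mathrm{Aut}(C/C')$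 with $C'\prec C$, and let $\mathrm{Gal}_L(\mathrm{Th}(C))=\mathrm{Aut}(C)/\mathrm{Autf}_L(C)$. Let $G^*_L$ be the subgroup of $G^*$ generated by all $a^{-1}b$ with $a,b\in G^*$ and $a=f(b)$ for some $f\in\mathrm{Autf}_L(M^*)$. Then $G^*_L$ is normal in $G^*$ and invariant under $\mathrm{Aut}(M^*)$, and the following hold. 1. $\mathrm{Aut}(N^*)=G^*\rtimes\mathrm{Aut}(M^*)$: the map $(g,f)\mapsto\bar g\circ\bar f$ is an isomorphism $G^*\rtimes\mathrm{Aut}(M^*)\to\mathrm{Aut}(N^*)$, where $\mathrm{Aut}(M^*)$ acts naturally on $G^*$. More precisely, every $F\in\mathrm{Aut}(N^*)$ is $\bar g\circ\bar f$, where $f=F|_{M^*}$ and $F(x_0)=g^{-1}\cdot x_0$. 2. Let $N'=(M',X')\prec N^*$ and let $G'=G(M')$. Then there is $h_0\in G^*$ with $h_0\cdot x_0\in X'$, and for every such $h_0$ we have $X'=G'\cdot(h_0\cdot x_0)$ and, for every $F\in\mathrm{Aut}(N^*)$, $$F\in\mathrm{Aut}(N^*/N')\iff F=\bar h_0^{-1}\circ\bar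 f\circ\bar h_0\ \text{ for some } f\in\mathrm{Aut}(M^*/M').$$ 3. $\mathrm{Autf}_L(N^*)=G^*_L\rtimes\mathrm{Autf}_L(M^*)$ and $\mathrm{Gal}_L(\mathrm{Th}(N))=G^*/G^*_L\rtimes\mathrm{Gal}_L(\mathrm{Th}(M))$: the map $(g,f)\mapsto\bar g\circ\bar f$ restricts to an isomorphism $G^*_L\rtimes\mathrm{Autf}_L(M^*)\to\mathrm{Autf}_L(N^*)$, and it induces an isomorphism $G^*/G^*_L\rtimes\mathrm{Gal}_L(\mathrm{Th}(M))\to\mathrm{Gal}_L(\mathrm{Th}(N))$, where all actions are induced by the action of $\mathrm{Aut}(M^*)$ on $G^*$. -/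

import Mathlib

open FirstOrder FirstOrder.Language

universe u v w w'

namespace AffineCopy

section Automorphisms

variable (L : FirstOrder.Language.{u, v}) (C : Type w) [L.Structure C]

/-- Automorphisms of an `L`-structure. -/
abbrev Aut : Type w := C ≃[L] C

/-- The automorphisms form a group under composition: `(f * g) c = f (g c)`. -/
instance autGroup : Group (Aut L C) where
  mul f g := f.comp g
  one := FirstOrder.Language.Equiv.refl L C
  inv f := f.symm
  mul_assoc _ _ _ := rfl
  one_mul _ := rfl
  mul_one _ := rfl
  inv_mul_cancel f := by
    apply FirstOrder.Language.Equiv.ext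
    intro x
    exact f.symm_apply_apply x

variable {L C}

@[simp] theorem aut_mul_apply (f g : Aut L C) (c : C) : (f * g) c = f (g c) := rfl

@[simp] theorem aut_one_apply (c : C) : (1 : Aut L C) c = c := rfl

@[simp] theorem aut_inv_apply_self (f : Aut L C) (c : C) : f⁻¹ (f c) = c :=
  f.symm_apply_apply c

@[simp] theorem aut_apply_inv_self (f : Aut L C) (c : C) : f (f⁻¹ c) = c :=
  f.apply_symm_apply c

variable (L C)

/-- `Aut(C/A)`: the automorphisms that fix the set `A` pointwise. -/
def fixing (A : Set C) : Subgroup (Aut L C) where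
  carrier := {f | ∀ c ∈ A, f c = c}
  one_mem' _ _ := rfl
  mul_mem' {f g} hf hg c hc := by
    rw [aut_mul_apply, hg c hc, hf c hc]
  inv_mem' {f} hf c hc := by
    have h := aut_inv_apply_self f c
    rwa [hf c hc] at h

/-- `Autf_L(C)`: the group of Lascar strong automorphisms, generated by the groups `Aut(C/M)`,
where `M` ranges over the elementary substructures of `C`. -/
def lascarStrong : Subgroup (Aut L C) :=
  Subgroup.closure {f | ∃ M : L.ElementarySubstructure C, f ∈ fixing L C (M : Set C)}

variable {L C}

/-- The image of an elementary substructure under an automorphism. -/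
theorem exists_image_elementary (σ : Aut L C) (M : L.ElementarySubstructure C) :
    ∃ M' : L.ElementarySubstructure C, (M' : Set C) = σ '' (M : Set C) := by
  let g := σ.toElementaryEmbedding.comp M.subtype
  have hr : (g.toHom.range : Set C) = σ '' (M : Set C) := by
    ext c
    constructor
    · rintro ⟨m, rfl⟩
      exact ⟨m, m.2, rfl⟩
    · rintro ⟨m, hm, rfl⟩
      exact ⟨⟨m, hm⟩, rfl⟩
  refine ⟨⟨g.toHom.range, ?_⟩, hr⟩
  intro n φ x
  let e : M ≃[L] g.toHom.range := g.toEmbedding.equivRange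
  have h1 : φ.Realize x ↔ φ.Realize (e.symm ∘ x) :=
    (StrongHomClass.realize_formula e.symm φ).symm
  have h2 : ((↑) ∘ x : Fin n → C) = g ∘ (e.symm ∘ x) := by
    funext i
    have h3 : e (e.symm (x i)) = x i := e.apply_symm_apply (x i)
    exact (congrArg Subtype.val h3).symm
  rw [h1, h2, g.map_formula]

instance lascarStrong_normal : (lascarStrong L C).Normal := by
  constructor
  intro f hf σ
  refine Subgroup.closure_induction
    (p := fun f _ => σ * f * σ⁻¹ ∈ lascarStrong L C) ?_ ?_ ?_ ?_ hf
  · rintro f ⟨M, hM⟩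
    obtain ⟨M', hM'⟩ := exists_image_elementary σ M
    refine Subgroup.subset_closure ⟨M', ?_⟩
    rw [hM']
    rintro _ ⟨m, hm, rfl⟩
    simp only [aut_mul_apply, aut_inv_apply_self]
    rw [hM m hm]
  · simp [one_mem]
  · intro f g _ _ hf hg
    have h := mul_mem hf hg
    simpa [mul_assoc] using h
  · intro f _ hf
    have h := inv_mem hf
    simpa [mul_assoc] using h

variable (L C)

/-- The Lascar group `Gal_L(T) = Aut(C) / Autf_L(C)` of `T = Th(C)`, computed in the monster
model `C`. -/
abbrev LascarGroup : Type w := Aut L C ⧸ lascarStrong L C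

/-- `|A| ≤ |T|`, where `|T|` is the cardinality of a complete theory in the language `L`. -/
def IsSmall (A : Set C) : Prop :=
  Cardinal.lift.{max u v} (Cardinal.mk A) ≤
    Cardinal.lift.{w} (max Cardinal.aleph0 L.card)

/-- `|T|⁺`-saturation: every set of formulas in one variable, with at most `|T|` parameters, that is
finitely satisfiable in `C` is satisfied by an element of `C`. -/
def IsSaturated : Prop :=
  ∀ A : Set C, IsSmall L C A → ∀ p : Set (L[[A]].Formula Unit),
    (∀ s : Finset (L[[A]].Formula Unit), ↑s ⊆ p → ∃ c : C, ∀ φ ∈ s, φ.Realize fun _ => c) →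
      ∃ c : C, ∀ φ ∈ p, φ.Realize fun _ => c

/-- Strong `|T|⁺`-homogeneity: every partial elementary map whose domain has at most `|T|` elements
extends to an automorphism. -/
def IsStronglyHomogeneous : Prop :=
  ∀ A : Set C, IsSmall L C A → ∀ f : A → C,
    (∀ φ : L.Formula A, φ.Realize ((↑) : A → C) ↔ φ.Realize f) →
      ∃ σ : Aut L C, ∀ a : A, σ a = f a

/-- Monster models of `Th(C)`. -/
structure IsMonster : Prop where
  saturated : IsSaturated L C
  homogeneous : IsStronglyHomogeneous L C

end Automorphisms

/-- A regular action: `X` is an affine copy of `G`. -/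
class IsAffineCopy (G : Type w) (X : Type w') [Group G] [MulAction G X] : Prop where
  nonempty : Nonempty X
  existsUnique : ∀ x y : X, ∃! g : G, g • x = y

/-- Parameter-free formulas that are meant to interpret a group: its elements are the classes of the
`n`-tuples satisfying `dom` modulo the equivalence relation `eqv`, and `mul` is the graph of its
multiplication. A definable group is the case in which `eqv` is equality. -/
structure GroupFormulas (L : FirstOrder.Language.{u, v}) where
  n : ℕ
  dom : L.Formula (Fin n)
  eqv : L.Formula (Fin n ⊕ Fin n)
  mul : L.Formula (Fin n ⊕ (Fin n ⊕ Fin n))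

namespace GroupFormulas

variable {L : FirstOrder.Language.{u, v}} (I : GroupFormulas L)

section Group

variable (M : Type w) [L.Structure M]

/-- The tuples in `M` that satisfy `dom`. -/
abbrev Dom : Type w := {a : Fin I.n → M // I.dom.Realize a}

variable {M} in
/-- The relation on tuples that is defined by `eqv`. -/
def Eqv (a b : I.Dom M) : Prop := I.eqv.Realize (Sum.elim a.1 b.1)

variable {M} in
/-- The relation on tuples that is defined by `mul`. -/
def Mul (a b c : I.Dom M) : Prop := I.mul.Realize (Sum.elim a.1 (Sum.elim b.1 c.1))

/-- The formulas interpret a group in `M`: `eqv` is an equivalence relation, and `mul` defines the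
graph of a group operation on the quotient. -/
class IsGroup : Prop where
  equivalence : Equivalence (I.Eqv (M := M))
  exists_group : ∃ _ : Group (Quotient ⟨I.Eqv (M := M), equivalence⟩), ∀ a b c : I.Dom M,
    I.Mul a b c ↔ (Quotient.mk ⟨I.Eqv (M := M), equivalence⟩ a) * Quotient.mk _ b = Quotient.mk _ c

variable {M}

/-- An automorphism acts on tuples coordinatewise. -/
def domMap (f : Aut L M) (a : I.Dom M) : I.Dom M :=
  ⟨f ∘ a.1, (StrongHomClass.realize_formula f I.dom).2 a.2⟩

theorem eqv_domMap (f : Aut L M) {a b : I.Dom M} :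
    I.Eqv (I.domMap f a) (I.domMap f b) ↔ I.Eqv a b := by
  have h := StrongHomClass.realize_formula f I.eqv (v := Sum.elim a.1 b.1)
  rw [Sum.comp_elim] at h
  exact h

theorem mul_domMap (f : Aut L M) {a b c : I.Dom M} :
    I.Mul (I.domMap f a) (I.domMap f b) (I.domMap f c) ↔ I.Mul a b c := by
  have h := StrongHomClass.realize_formula f I.mul (v := Sum.elim a.1 (Sum.elim b.1 c.1))
  rw [Sum.comp_elim, Sum.comp_elim] at h
  exact h

variable (M)

variable [I.IsGroup M]

/-- Equality of the elements of the group that are represented by tuples. -/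
def setoid : Setoid (I.Dom M) := ⟨I.Eqv, IsGroup.equivalence⟩

/-- The group `G = G(M)` interpreted in `M`. -/
def Carrier : Type w := Quotient (I.setoid M)

variable {M} in
/-- The element of `G(M)` represented by a tuple. -/
def cls (a : I.Dom M) : I.Carrier M := Quotient.mk (I.setoid M) a

noncomputable instance carrierGroup : Group (I.Carrier M) :=
  (IsGroup.exists_group (I := I) (M := M)).choose

variable {M}

theorem cls_surjective : Function.Surjective (I.cls (M := M)) := Quotient.mk_surjective

theorem cls_eq_cls {a b : I.Dom M} : I.cls a = I.cls b ↔ I.Eqv a b :=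
  Quotient.eq (r := I.setoid M)

theorem cls_mul_cls {a b c : I.Dom M} : I.cls a * I.cls b = I.cls c ↔ I.Mul a b c :=
  ((IsGroup.exists_group (I := I) (M := M)).choose_spec a b c).symm

/-- The action of an automorphism of `M` on `G(M)`. -/
def groupMap (f : Aut L M) : I.Carrier M → I.Carrier M :=
  Quotient.map (I.domMap f) fun _ _ h => (I.eqv_domMap f).2 h

theorem groupMap_cls (f : Aut L M) (a : I.Dom M) : I.groupMap f (I.cls a) = I.cls (I.domMap f a) :=
  rfl

theorem groupMap_mul (f : Aut L M) (g h : I.Carrier M) :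
    I.groupMap f (g * h) = I.groupMap f g * I.groupMap f h := by
  obtain ⟨a, rfl⟩ := I.cls_surjective g
  obtain ⟨b, rfl⟩ := I.cls_surjective h
  obtain ⟨c, hc⟩ := I.cls_surjective (I.cls a * I.cls b)
  rw [← hc]
  simp only [groupMap_cls]
  exact (I.cls_mul_cls.2 ((I.mul_domMap f).2 (I.cls_mul_cls.1 hc.symm))).symm

variable (M)

/-- The action of `Aut(M)` on the group `G(M)`, `f • [a] = [f(a)]`. -/
noncomputable def autAction : Aut L M →* MulAut (I.Carrier M) where
  toFun f :=
    { toFun := I.groupMap f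
      invFun := I.groupMap f⁻¹
      left_inv := by
        intro g
        obtain ⟨a, rfl⟩ := I.cls_surjective g
        simp only [groupMap_cls]
        exact congrArg I.cls (Subtype.ext (funext fun i => aut_inv_apply_self f _))
      right_inv := by
        intro g
        obtain ⟨a, rfl⟩ := I.cls_surjective g
        simp only [groupMap_cls]
        exact congrArg I.cls (Subtype.ext (funext fun i => aut_apply_inv_self f _))
      map_mul' := I.groupMap_mul f }
  map_one' := by
    ext g
    obtain ⟨a, rfl⟩ := I.cls_surjective g
    rfl
  map_mul' f f' := by
    ext g
    obtain ⟨a, rfl⟩ := I.cls_surjective g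
    rfl

variable {M}

@[simp] theorem autAction_cls (f : Aut L M) (a : I.Dom M) :
    I.autAction M f (I.cls a) = I.cls (I.domMap f a) := rfl

variable (M)

/-- Equality `E_L` of Lascar strong types on `G(M)`: `E_L(a, b)` if `a = f(b)` for some Lascar
strong automorphism `f`. -/
def EL (a b : I.Carrier M) : Prop := ∃ f ∈ lascarStrong L M, a = I.autAction M f b

/-- The subgroup `G_L` of `G(M)` generated by the `E_L`-commutators `a⁻¹ b`, where `E_L(a, b)`. -/
noncomputable def lascarSubgroup : Subgroup (I.Carrier M) :=
  Subgroup.closure {g | ∃ a b : I.Carrier M, I.EL M a b ∧ g = a⁻¹ * b}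

variable {M}

theorem inv_mul_mem_lascarSubgroup {f : Aut L M} (hf : f ∈ lascarStrong L M) (g : I.Carrier M) :
    (I.autAction M f g)⁻¹ * g ∈ I.lascarSubgroup M :=
  Subgroup.subset_closure ⟨_, g, ⟨f, hf, rfl⟩, rfl⟩

instance lascarSubgroup_normal : (I.lascarSubgroup M).Normal := by
  constructor
  intro g hg x
  refine Subgroup.closure_induction
    (p := fun g _ => x * g * x⁻¹ ∈ I.lascarSubgroup M) ?_ ?_ ?_ ?_ hg
  · rintro _ ⟨a, b, ⟨f, hf, rfl⟩, rfl⟩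
    have h1 := I.inv_mul_mem_lascarSubgroup hf (b * x⁻¹)
    have h5 : x * ((I.autAction M f b)⁻¹ * b) * x⁻¹ =
        (x * I.autAction M f x⁻¹) * ((I.autAction M f (b * x⁻¹))⁻¹ * (b * x⁻¹)) := by
      simp only [map_mul]
      group
    rw [h5]
    refine mul_mem ?_ h1
    have h6 : x * I.autAction M f x⁻¹ = ((I.autAction M f x⁻¹)⁻¹ * x⁻¹)⁻¹ := by group
    rw [h6]
    exact inv_mem (I.inv_mul_mem_lascarSubgroup hf x⁻¹)
  · simp [one_mem]
  · intro a b _ _ ha hb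
    have h := mul_mem ha hb
    simpa [mul_assoc] using h
  · intro a _ ha
    have h := inv_mem ha
    simpa [mul_assoc] using h

theorem autAction_mem_lascarSubgroup (f : Aut L M) {g : I.Carrier M}
    (hg : g ∈ I.lascarSubgroup M) : I.autAction M f g ∈ I.lascarSubgroup M := by
  refine Subgroup.closure_induction
    (p := fun g _ => I.autAction M f g ∈ I.lascarSubgroup M) ?_ ?_ ?_ ?_ hg
  · rintro _ ⟨a, b, ⟨σ, hσ, rfl⟩, rfl⟩
    have h := I.inv_mul_mem_lascarSubgroup
      (lascarStrong_normal.conj_mem σ hσ f) (I.autAction M f b)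
    simpa using h
  · simp [one_mem]
  · intro a b _ _ ha hb
    simpa using mul_mem ha hb
  · intro a _ ha
    simpa using ha

variable (M)

/-- The action of `Autf_L(M)` on `G_L`. -/
noncomputable def lascarAction : lascarStrong L M →* MulAut (I.lascarSubgroup M) where
  toFun f :=
    { toFun := fun g => ⟨I.autAction M f g, I.autAction_mem_lascarSubgroup f g.2⟩
      invFun := fun g =>
        ⟨I.autAction M (f⁻¹ : lascarStrong L M) g, I.autAction_mem_lascarSubgroup _ g.2⟩
      left_inv := fun g => Subtype.ext (by simp)
      right_inv := fun g => Subtype.ext (by simp)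
      map_mul' := fun g h => Subtype.ext (by simp) }
  map_one' := by ext g; simp
  map_mul' f f' := by ext g; simp

/-- `Aut(M)` acts on the quotient `G / G_L`. -/
noncomputable def quotientAction : Aut L M →* MulAut (I.Carrier M ⧸ I.lascarSubgroup M) where
  toFun f := QuotientGroup.congr _ _ (I.autAction M f) (by
    ext g
    constructor
    · rintro ⟨h, hh, rfl⟩
      exact I.autAction_mem_lascarSubgroup f hh
    · intro hg
      exact ⟨I.autAction M f⁻¹ g, I.autAction_mem_lascarSubgroup _ hg, by simp⟩)
  map_one' := by
    ext g
    induction g using QuotientGroup.induction_on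
    simp
  map_mul' f f' := by
    ext g
    induction g using QuotientGroup.induction_on
    simp

/-- The action of the Lascar group of `M` on `G / G_L` that is induced by the action of `Aut(M)`
on `G`. -/
noncomputable def galAction : LascarGroup L M →* MulAut (I.Carrier M ⧸ I.lascarSubgroup M) :=
  QuotientGroup.lift _ (I.quotientAction M) (by
    intro f hf
    rw [MonoidHom.mem_ker]
    ext g
    induction g using QuotientGroup.induction_on with
    | H g =>
      change ((I.autAction M f g : I.Carrier M) : I.Carrier M ⧸ I.lascarSubgroup M) = (g : _)
      exact QuotientGroup.eq.2 (I.inv_mul_mem_lascarSubgroup hf g))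

end Group

/-- The relation symbols of the two-sorted structure `(M, X, ·)`, presented in a single sorted
language: the relation symbols of `L` on the sort `M`, the graphs of the function symbols of `L` on
the sort `M`, a predicate for the sort `X`, and the relation `[a] · x = y`. -/
inductive PairRel {L : FirstOrder.Language.{u, v}} (I : GroupFormulas L) : ℕ → Type (max u v)
  | rel {k : ℕ} (R : L.Relations k) : PairRel I k
  | graph {k : ℕ} (f : L.Functions k) : PairRel I (k + 1)
  | sortX : PairRel I 1
  | act : PairRel I (I.n + 2)

/-- The language of the two-sorted structure `(M, X, ·)`. -/
def pairLanguage : FirstOrder.Language.{0, max u v} := ⟨fun _ => Empty, I.PairRel⟩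

/-- The universe of the structure `N = (M, X, ·)`: the disjoint union of its two sorts. -/
def Pair (_ : GroupFormulas L) (M : Type w) (X : Type w') : Type (max w w') := M ⊕ X

section Pair

variable {M : Type w} {X : Type w'}

/-- The inclusion of the sort `M` into `N = (M, X, ·)`. -/
def inM (m : M) : I.Pair M X := Sum.inl m

/-- The inclusion of the sort `X` into `N = (M, X, ·)`. -/
def inX (x : X) : I.Pair M X := Sum.inr x

/-- The map on `N = (M, X, ·)` given by a map on each of the sorts. -/
def pairMap (p : M → M) (q : X → X) : I.Pair M X → I.Pair M X := Sum.map p q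

variable [L.Structure M] [I.IsGroup M] [MulAction (I.Carrier M) X]

/-- The interpretation of the relation symbols in `N = (M, X, ·)`. -/
def pairRelMap : ∀ {k : ℕ}, I.PairRel k → (Fin k → I.Pair M X) → Prop
  | _, .rel R, v => ∃ a, v = I.inM ∘ a ∧ Structure.RelMap R a
  | _, .graph f, v => ∃ a : Fin _ → M, v = I.inM ∘ Fin.snoc a (Structure.funMap f a)
  | _, .sortX, v => ∃ x, v = fun _ => I.inX x
  | _, .act, v => ∃ (a : I.Dom M) (x : X),
      v = Fin.append (I.inM ∘ a.1) ![I.inX x, I.inX (I.cls a • x)]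

/-- The structure `N = (M, X, ·)`. -/
instance pairStructure : I.pairLanguage.Structure (I.Pair M X) where
  funMap f _ := f.elim
  RelMap R v := I.pairRelMap R v

theorem pairRelMap_of_map (f : Aut L M) (q : X → X)
    (hq : ∀ (g : I.Carrier M) (x : X), q (g • x) = I.autAction M f g • q x)
    {k : ℕ} (r : I.PairRel k) (v : Fin k → I.Pair M X) (h : I.pairRelMap r v) :
    I.pairRelMap r (I.pairMap f q ∘ v) := by
  cases r with
  | rel R =>
    obtain ⟨a, rfl, ha⟩ := h
    exact ⟨f ∘ a, rfl, (f.map_rel R a).2 ha⟩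
  | graph F =>
    obtain ⟨a, rfl⟩ := h
    refine ⟨f ∘ a, ?_⟩
    rw [← f.map_fun F a, ← Fin.comp_snoc]
    rfl
  | sortX =>
    obtain ⟨x, rfl⟩ := h
    exact ⟨q x, rfl⟩
  | act =>
    obtain ⟨a, x, rfl⟩ := h
    refine ⟨I.domMap f a, q x, ?_⟩
    rw [← I.autAction_cls, ← hq]
    funext i
    refine Fin.addCases (fun i => ?_) (fun i => ?_) i
    · rw [Function.comp_apply, Fin.append_left, Fin.append_left]
      rfl
    · rw [Function.comp_apply, Fin.append_right, Fin.append_right]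
      fin_cases i <;> rfl

/-- The automorphism of `N = (M, X, ·)` given by an automorphism `f` of `M` and a compatible
permutation of `X`. -/
def pairAut (f : Aut L M) (q : X ≃ X)
    (hq : ∀ (g : I.Carrier M) (x : X), q (g • x) = I.autAction M f g • q x) :
    Aut I.pairLanguage (I.Pair M X) where
  toEquiv := Equiv.sumCongr f.toEquiv q
  map_fun' F _ := F.elim
  map_rel' r v := by
    constructor
    · intro h
      have hq' : ∀ (g : I.Carrier M) (x : X),
          q.symm (g • x) = I.autAction M f⁻¹ g • q.symm x := by
        intro g x
        rw [Equiv.symm_apply_eq, hq]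
        simp
      have h' := I.pairRelMap_of_map f⁻¹ q.symm hq' r _ h
      have hv : I.pairMap (f⁻¹ : Aut L M) q.symm ∘
          ((Equiv.sumCongr f.toEquiv q).toFun ∘ v) = v :=
        funext fun i => (Equiv.sumCongr f.toEquiv q).symm_apply_apply (v i)
      exact hv ▸ h'
    · exact I.pairRelMap_of_map f q hq r v

variable [IsAffineCopy (I.Carrier M) X]

/-- The element `h` of `G` with `h · x₀ = x`. -/
noncomputable def coord (x₀ x : X) : I.Carrier M :=
  (IsAffineCopy.existsUnique (G := I.Carrier M) x₀ x).choose

@[simp] theorem coord_smul (x₀ x : X) : (I.coord x₀ x : I.Carrier M) • x₀ = x :=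
  (IsAffineCopy.existsUnique (G := I.Carrier M) x₀ x).choose_spec.1

theorem smul_inj (x₀ : X) {g h : I.Carrier M} (e : g • x₀ = h • x₀) : g = h :=
  (IsAffineCopy.existsUnique (G := I.Carrier M) x₀ (h • x₀)).unique e rfl

@[simp] theorem coord_smul_self (x₀ : X) (g : I.Carrier M) : I.coord x₀ (g • x₀) = g :=
  I.smul_inj x₀ (I.coord_smul x₀ _)

theorem coord_smul_left (x₀ x : X) (g : I.Carrier M) :
    I.coord x₀ (g • x) = g * I.coord x₀ x :=
  I.smul_inj x₀ (by rw [mul_smul, coord_smul, coord_smul])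

/-- The embedding `f ↦ f̄` of `Aut(M)` into `Aut(N)`: `f̄` extends `f` and
`f̄(h · x₀) = f(h) · x₀`. -/
noncomputable def liftAut (x₀ : X) : Aut L M →* Aut I.pairLanguage (I.Pair M X) where
  toFun f := I.pairAut f
    { toFun := fun x => I.autAction M f (I.coord x₀ x) • x₀
      invFun := fun x => I.autAction M f⁻¹ (I.coord x₀ x) • x₀
      left_inv := fun x => by simp
      right_inv := fun x => by simp }
    (fun g x => by simp [coord_smul_left, mul_smul])
  map_one' := by
    ext c
    rcases c with m | x
    · rfl
    · exact congrArg Sum.inr (by simp)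
  map_mul' f f' := by
    ext c
    rcases c with m | x
    · rfl
    · exact congrArg Sum.inr (by simp)

/-- The embedding `g ↦ ḡ` of `G` into `Aut(N)`: `ḡ` is the identity on `M` and
`ḡ(h · x₀) = (h g⁻¹) · x₀`. -/
noncomputable def liftGroup (x₀ : X) : I.Carrier M →* Aut I.pairLanguage (I.Pair M X) where
  toFun g := I.pairAut 1
    { toFun := fun x => (I.coord x₀ x * g⁻¹) • x₀
      invFun := fun x => (I.coord x₀ x * g) • x₀
      left_inv := fun x => by simp
      right_inv := fun x => by simp }
    (fun h x => by simp [coord_smul_left, mul_smul])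
  map_one' := by
    ext c
    rcases c with m | x
    · rfl
    · exact congrArg Sum.inr (by simp)
  map_mul' g g' := by
    ext c
    rcases c with m | x
    · rfl
    · exact congrArg Sum.inr (by simp [mul_assoc])

theorem liftAut_inM (x₀ : X) (f : Aut L M) (m : M) :
    I.liftAut x₀ f (I.inM m) = I.inM (f m) := rfl

theorem liftAut_inX (x₀ : X) (f : Aut L M) (h : I.Carrier M) :
    I.liftAut x₀ f (I.inX (h • x₀)) = I.inX (I.autAction M f h • x₀) :=
  congrArg Sum.inr (by simp)

theorem liftGroup_inM (x₀ : X) (g : I.Carrier M) (m : M) :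
    I.liftGroup x₀ g (I.inM m : I.Pair M X) = I.inM m := rfl

theorem liftGroup_inX (x₀ : X) (g h : I.Carrier M) :
    I.liftGroup x₀ g (I.inX (h • x₀)) = I.inX ((h * g⁻¹) • x₀) :=
  congrArg Sum.inr (by simp)

/-- The trace on the sort `M` of a subset of `N = (M, X, ·)`. -/
def traceM (A : Set (I.Pair M X)) : Set M := {m | I.inM m ∈ A}

end Pair

/-- The elements of `G(M)` that are represented by tuples in `A`; if `A` is the universe of an
elementary substructure `M'` of `M`, this is the subgroup `G(M')` of `G(M)`. -/
def groupPoints {M : Type w} [L.Structure M] [I.IsGroup M] (A : Set M) : Set (I.Carrier M) :=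
  {g | ∃ a : I.Dom M, (∀ i, a.1 i ∈ A) ∧ g = I.cls a}

end GroupFormulas

end AffineCopy

/-! An automorphism of `N` preserves the sort `X`, hence also `M`. Since `X` is a single `G`-orbit,
the automorphism is determined by its restriction `f` to `M` and by the image of one point
(`pairAut_ext`). Comparing it with `ḡ f̄`, where `g⁻¹ • x₀` is the image of `x₀`, gives the
decomposition; the semidirect law is `f̄ ḡ = (f(g))‾ f̄` (`liftAut_mul_liftGroup`). Conjugation by
`h̄` moves the base point to `h • x₀` and yields the key identity `h̄⁻¹ f̄ h̄ = (h⁻¹ f(h))‾ f̄`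
(`conj_liftAut_eq`).

An automorphism that fixes `N' ≺ N` pointwise fixes some `h₀ • x₀`, so it is `h̄₀⁻¹ f̄ h̄₀` with `f`
fixing `M'` (`mem_fixing_iff`). Its `G`-component `h₀⁻¹ f(h₀)` is the inverse of an
`E_L`-commutator, which is how `G_L` enters.

Matching the Lascar strong automorphisms of `N` with those of `M` needs elementarity to pass both
ways. `M` is definable in `N`, so `N' ≺ N` gives `M' ≺ M` (`exists_elementary_traceM`). Conversely,
once `x₀` is named, `N` is interpreted in `M`, the point `[a] • x₀` being coded by the tuple `a`;
hence `S ≺ M` gives `(S, G(S) · x₀) ≺ N` (`exists_elementary_pair`). Then `ḡ f̄` is Lascar strong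
exactly when `g ∈ G_L` and `f` is Lascar strong, and the Lascar group of `N` follows by passing to
quotients. -/

namespace FirstOrder.Language.ElementarySubstructure

variable {L : FirstOrder.Language.{u, v}} {M : Type w} [L.Structure M]

/-- An elementary substructure contains witnesses for existential statements about its elements. -/
theorem exists_realize {γ δ : Type*} [Finite δ] (S : L.ElementarySubstructure M)
    (ψ : L.Formula (γ ⊕ δ)) {z : γ → M} (hz : ∀ i, z i ∈ S) {d : δ → M}
    (h : ψ.Realize (Sum.elim z d)) :
    ∃ d' : δ → M, (∀ i, d' i ∈ S) ∧ ψ.Realize (Sum.elim z d') := by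
  let z' : γ → S := fun i => ⟨z i, hz i⟩
  have h1 : (ψ.iExs δ).Realize (S.subtype ∘ z') := Formula.realize_iExs.2 ⟨d, h⟩
  rw [S.subtype.map_formula, Formula.realize_iExs] at h1
  obtain ⟨e, he⟩ := h1
  rw [← S.subtype.map_formula, Sum.comp_elim] at he
  exact ⟨S.subtype ∘ e, fun i => (e i).2, he⟩

end FirstOrder.Language.ElementarySubstructure

namespace AffineCopy

theorem aut_ext {L : FirstOrder.Language.{u, v}} {C : Type w} [L.Structure C] {f g : Aut L C}
    (h : ∀ c, f c = g c) : f = g :=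
  FirstOrder.Language.Equiv.ext h

namespace GroupFormulas

variable {L : FirstOrder.Language.{u, v}} (I : GroupFormulas L)

/-! ### The basic relations of `(M, X, ·)` -/

section Relations

variable {M : Type w} {X : Type w'}

theorem inM_injective : Function.Injective (I.inM : M → I.Pair M X) := Sum.inl_injective

theorem inX_injective : Function.Injective (I.inX : X → I.Pair M X) := Sum.inr_injective

theorem inM_ne_inX (m : M) (x : X) : (I.inM m : I.Pair M X) ≠ I.inX x := Sum.inl_ne_inr

theorem pair_cases (c : I.Pair M X) : (∃ m, c = I.inM m) ∨ ∃ x, c = I.inX x := by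
  rcases c with m | x
  · exact .inl ⟨m, rfl⟩
  · exact .inr ⟨x, rfl⟩

variable [L.Structure M] [I.IsGroup M] [MulAction (I.Carrier M) X]

theorem relMap_rel {k : ℕ} (R : L.Relations k) (a : Fin k → M) :
    Structure.RelMap (L := I.pairLanguage) (PairRel.rel R) (I.inM ∘ a : Fin k → I.Pair M X) ↔
      Structure.RelMap R a := by
  constructor
  · rintro ⟨b, hb, h⟩
    rwa [I.inM_injective.comp_left hb]
  · exact fun h => ⟨a, rfl, h⟩

theorem relMap_graph {k : ℕ} (f : L.Functions k) (a : Fin (k + 1) → M) :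
    Structure.RelMap (L := I.pairLanguage) (PairRel.graph f) (I.inM ∘ a : _ → I.Pair M X) ↔
      a (Fin.last k) = Structure.funMap f (Fin.init a) := by
  constructor
  · rintro ⟨b, hb⟩
    rw [I.inM_injective.comp_left hb]
    simp
  · intro h
    refine ⟨Fin.init a, ?_⟩
    rw [← h, Fin.snoc_init_self]

theorem relMap_sortX (v : Fin 1 → I.Pair M X) :
    Structure.RelMap (L := I.pairLanguage) PairRel.sortX v ↔ ∃ x, v 0 = I.inX x := by
  constructor
  · rintro ⟨x, rfl⟩
    exact ⟨x, rfl⟩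
  · rintro ⟨x, h⟩
    exact ⟨x, funext fun i => by rw [Subsingleton.elim i 0, h]⟩

theorem relMap_act_iff (v : Fin (I.n + 2) → I.Pair M X) :
    Structure.RelMap (L := I.pairLanguage) PairRel.act v ↔
      ∃ (a : I.Dom M) (x : X), (∀ i, v (Fin.castAdd 2 i) = I.inM (a.1 i)) ∧
        v (Fin.natAdd I.n 0) = I.inX x ∧ v (Fin.natAdd I.n 1) = I.inX (I.cls a • x) := by
  constructor
  · rintro ⟨a, x, rfl⟩
    exact ⟨a, x, fun i => by rw [Fin.append_left]; rfl, by rw [Fin.append_right]; rfl,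
      by rw [Fin.append_right]; rfl⟩
  · rintro ⟨a, x, h1, h2, h3⟩
    refine ⟨a, x, funext fun i => Fin.addCases (fun i => ?_) (fun i => ?_) i⟩
    · rw [h1, Fin.append_left]
      rfl
    · rw [Fin.append_right]
      fin_cases i
      exacts [h2, h3]

end Relations

/-! ### Restricting automorphisms to the sort `M` -/

section Restriction

variable {M : Type w} {X : Type w'} [L.Structure M] [I.IsGroup M] [MulAction (I.Carrier M) X]

theorem exists_aut_inX (F : Aut I.pairLanguage (I.Pair M X)) (x : X) :
    ∃ y, F (I.inX x) = I.inX y :=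
  (I.relMap_sortX _).1 ((F.map_rel PairRel.sortX fun _ => I.inX x).2 ⟨x, rfl⟩)

/-- The sort `M` is only visible as the complement of the sort `X`, so the argument applies
preservation of `X` to `F⁻¹`. -/
theorem exists_aut_inM (F : Aut I.pairLanguage (I.Pair M X)) (m : M) :
    ∃ n, F (I.inM m) = I.inM n := by
  rcases I.pair_cases (F (I.inM m)) with h | ⟨x, h⟩
  · exact h
  · obtain ⟨y, hy⟩ := I.exists_aut_inX F⁻¹ x
    rw [← h, aut_inv_apply_self] at hy
    exact (I.inM_ne_inX _ _ hy).elim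

/-- Every automorphism of `N = (M, X, ·)` restricts to an automorphism of `M`. -/
theorem exists_restriction (F : Aut I.pairLanguage (I.Pair M X)) :
    ∃ f : Aut L M, ∀ m, F (I.inM m) = I.inM (f m) := by
  choose p hp using I.exists_aut_inM F
  choose q hq using I.exists_aut_inM F⁻¹
  have hcomp : ∀ {k : ℕ} (a : Fin k → M), (F ∘ (I.inM ∘ a) : Fin k → I.Pair M X) = I.inM ∘ (p ∘ a) :=
    fun a => funext fun i => hp (a i)
  refine ⟨⟨⟨p, q, fun m => ?_, fun m => ?_⟩, fun {k} φ a => ?_, fun {k} R a => ?_⟩, hp⟩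
  · apply I.inM_injective (X := X)
    rw [← hq, ← hp, aut_inv_apply_self]
  · apply I.inM_injective (X := X)
    rw [← hp, ← hq, aut_apply_inv_self]
  -- Function symbols survive in `N` only as graphs; preservation of the graph at the tuple `(a,
  -- φ(a))` is compatibility with `φ`.
  · have h := F.map_rel (PairRel.graph φ) (I.inM ∘ (Fin.snoc a (Structure.funMap φ a) : _ → M))
    rw [hcomp, relMap_graph, relMap_graph, Fin.comp_snoc] at h
    simpa using h.2 (by simp)
  · have h := F.map_rel (PairRel.rel R) (I.inM ∘ a)
    rwa [hcomp, relMap_rel, relMap_rel] at h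

/-- `F` preserves the relation `act` on `(a, x, [a] • x)`, and the last entry of a tuple in `act` is
determined by the others. Thus one value of `F` on `X`, together with `f`, determines `F` on the
whole orbit. -/
theorem aut_inX_smul {F : Aut I.pairLanguage (I.Pair M X)} {f : Aut L M}
    (hf : ∀ m, F (I.inM m) = I.inM (f m)) {x y : X} (h : F (I.inX x) = I.inX y) (g : I.Carrier M) :
    F (I.inX (g • x)) = I.inX (I.autAction M f g • y) := by
  obtain ⟨a, rfl⟩ := I.cls_surjective g
  have h1 := (F.map_rel PairRel.act
    (Fin.append (I.inM ∘ a.1) ![I.inX x, I.inX (I.cls a • x)])).2 ⟨a, x, rfl⟩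
  obtain ⟨b, z, hb, hz, hw⟩ := (I.relMap_act_iff _).1 h1
  simp only [Function.comp_apply, Fin.append_left, Fin.append_right, hf, h, Matrix.cons_val_zero,
    Matrix.cons_val_one] at hb hz hw
  rw [hw, ← I.inX_injective hz, autAction_cls]
  congr 3
  exact Subtype.ext (funext fun i => (I.inM_injective (hb i)).symm)

end Restriction

/-! ### The decomposition of the automorphism group of `N` -/

section Decomposition

variable {M : Type w} {X : Type w'} [L.Structure M] [I.IsGroup M] [MulAction (I.Carrier M) X]
  [IsAffineCopy (I.Carrier M) X] (x₀ : X)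

/-- Two automorphisms of `N = (M, X, ·)` are equal if they agree on `M` and in one point of `X`. -/
theorem pairAut_ext {F F' : Aut I.pairLanguage (I.Pair M X)} (x : X)
    (hM : ∀ m, F (I.inM m) = F' (I.inM m)) (hX : F (I.inX x) = F' (I.inX x)) : F = F' := by
  obtain ⟨f, hf⟩ := I.exists_restriction F
  obtain ⟨y, hy⟩ := I.exists_aut_inX F x
  apply aut_ext
  intro c
  rcases I.pair_cases c with ⟨m, rfl⟩ | ⟨z, rfl⟩
  · exact hM m
  · rw [← I.coord_smul (M := M) x z, I.aut_inX_smul hf hy,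
      I.aut_inX_smul (fun m => (hM m).symm.trans (hf m)) (hX.symm.trans hy)]

theorem liftAut_inX_self (f : Aut L M) : I.liftAut x₀ f (I.inX x₀) = I.inX x₀ := by
  simpa using I.liftAut_inX x₀ f 1

theorem liftGroup_inX_self (g : I.Carrier M) :
    I.liftGroup x₀ g (I.inX x₀) = I.inX (g⁻¹ • x₀) := by
  simpa using I.liftGroup_inX x₀ g 1

theorem lift_inM (g : I.Carrier M) (f : Aut L M) (m : M) :
    (I.liftGroup x₀ g * I.liftAut x₀ f) (I.inM m) = I.inM (f m) := rfl

theorem lift_inX_self (g : I.Carrier M) (f : Aut L M) :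
    (I.liftGroup x₀ g * I.liftAut x₀ f) (I.inX x₀) = I.inX (g⁻¹ • x₀) := by
  rw [aut_mul_apply, liftAut_inX_self, liftGroup_inX_self]

/-- The commutation law behind the semidirect product: both sides restrict to `f` on `M` and send
`x₀` to `f(g)⁻¹ • x₀`. -/
theorem liftAut_mul_liftGroup (g : I.Carrier M) (f : Aut L M) :
    I.liftAut x₀ f * I.liftGroup x₀ g =
      I.liftGroup x₀ (I.autAction M f g) * I.liftAut x₀ f := by
  refine I.pairAut_ext x₀ (fun m => rfl) ?_
  rw [lift_inX_self, aut_mul_apply, liftGroup_inX_self, liftAut_inX, map_inv]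

theorem lift_mul_lift (g g' : I.Carrier M) (f f' : Aut L M) :
    I.liftGroup x₀ g * I.liftAut x₀ f * (I.liftGroup x₀ g' * I.liftAut x₀ f') =
      I.liftGroup x₀ (g * I.autAction M f g') * I.liftAut x₀ (f * f') := by
  rw [map_mul, map_mul, mul_assoc, ← mul_assoc (I.liftAut x₀ f), liftAut_mul_liftGroup]
  simp only [mul_assoc]

theorem exists_eq_lift (F : Aut I.pairLanguage (I.Pair M X)) :
    ∃ (g : I.Carrier M) (f : Aut L M), (∀ m : M, F (I.inM m) = I.inM (f m)) ∧
      F (I.inX x₀) = I.inX (g⁻¹ • x₀) ∧ F = I.liftGroup x₀ g * I.liftAut x₀ f := by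
  obtain ⟨f, hf⟩ := I.exists_restriction F
  obtain ⟨y, hy⟩ := I.exists_aut_inX F x₀
  -- Since `ḡ` sends `x₀` to `g⁻¹ • x₀`, the right `g` is the inverse of the coordinate of `F(x₀)`.
  have h : F (I.inX x₀) = I.inX ((I.coord x₀ y : I.Carrier M)⁻¹⁻¹ • x₀) := by simpa using hy
  exact ⟨(I.coord x₀ y)⁻¹, f, hf, h, I.pairAut_ext x₀ hf (h.trans (I.lift_inX_self x₀ _ f).symm)⟩

theorem lift_inj {g g' : I.Carrier M} {f f' : Aut L M}
    (h : I.liftGroup x₀ g * I.liftAut x₀ f = I.liftGroup x₀ g' * I.liftAut x₀ f') :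
    g = g' ∧ f = f' := by
  constructor
  · have h1 := I.lift_inX_self x₀ g f
    rw [h, lift_inX_self] at h1
    exact (inv_injective (I.smul_inj x₀ (I.inX_injective h1))).symm
  · refine aut_ext fun m => I.inM_injective (X := X) ?_
    rw [← I.lift_inM x₀ g f, h, lift_inM]

/-- `Aut(N) = G ⋊ Aut(M)`. -/
noncomputable def semidirectEquiv :
    I.Carrier M ⋊[I.autAction M] Aut L M ≃* Aut I.pairLanguage (I.Pair M X) :=
  MulEquiv.ofBijective
    (SemidirectProduct.lift (I.liftGroup x₀) (I.liftAut x₀) fun f => by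
      ext1 g
      exact eq_mul_inv_of_mul_eq (I.liftAut_mul_liftGroup x₀ g f).symm)
    ⟨fun p q h => SemidirectProduct.ext_iff.2 (I.lift_inj x₀ h), fun F => by
      obtain ⟨g, f, -, -, h⟩ := I.exists_eq_lift x₀ F
      exact ⟨⟨g, f⟩, h.symm⟩⟩

theorem semidirectEquiv_apply (p : I.Carrier M ⋊[I.autAction M] Aut L M) :
    I.semidirectEquiv x₀ p = I.liftGroup x₀ p.left * I.liftAut x₀ p.right := rfl

/-- Moving the base point from `x₀` to `h • x₀`. -/
theorem conj_liftAut_eq (h : I.Carrier M) (f : Aut L M) :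
    (I.liftGroup x₀ h)⁻¹ * I.liftAut x₀ f * I.liftGroup x₀ h =
      I.liftGroup x₀ (h⁻¹ * I.autAction M f h) * I.liftAut x₀ f := by
  rw [mul_assoc, liftAut_mul_liftGroup, map_mul, map_inv, mul_assoc]

end Decomposition

/-! ### Elementary substructures of `N` and their pointwise stabilizers -/

section ElementarySubstructures

variable {M : Type w} {X : Type w'} [L.Structure M] [I.IsGroup M] [MulAction (I.Carrier M) X]
  (N' : I.pairLanguage.ElementarySubstructure (I.Pair M X))

theorem exists_inX_mem [Nonempty X] : ∃ x : X, I.inX x ∈ N' := by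
  obtain ⟨x⟩ := ‹Nonempty X›
  obtain ⟨d, hd, h⟩ := N'.exists_realize (γ := Empty) (δ := Fin 1) (z := Empty.elim)
    (d := fun _ => I.inX x)
    (Relations.formula (L := I.pairLanguage) PairRel.sortX fun i => Term.var (.inr i)) nofun
    (Formula.realize_rel.2 ⟨x, rfl⟩)
  obtain ⟨y, hy⟩ := (I.relMap_sortX _).1 (Formula.realize_rel.1 h)
  exact ⟨y, hy ▸ hd 0⟩

/-- The point `[a] • x` is the only solution of `act(a, x, ·)`, so the witness that elementarity
provides must be this point. -/
theorem inX_smul_mem {a : I.Dom M} (ha : ∀ i, I.inM (a.1 i) ∈ N') {x : X} (hx : I.inX x ∈ N') :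
    I.inX (I.cls a • x) ∈ N' := by
  obtain ⟨d, hd, h⟩ := N'.exists_realize (γ := Fin I.n ⊕ Unit) (δ := Unit)
    (z := Sum.elim (I.inM ∘ a.1) fun _ => I.inX x) (d := fun _ => I.inX (I.cls a • x))
    (Relations.formula (L := I.pairLanguage) PairRel.act
      fun i => Term.var (Fin.append (fun i => .inl (.inl i)) ![.inl (.inr ()), .inr ()] i))
    (by rintro (i | i); exacts [ha i, hx])
    (Formula.realize_rel.2 ((I.relMap_act_iff _).2 ⟨a, x, by simp⟩))
  obtain ⟨b, y, hb, hy, hz⟩ := (I.relMap_act_iff _).1 (Formula.realize_rel.1 h)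
  simp only [Term.realize_var, Fin.append_left, Fin.append_right, Matrix.cons_val_zero,
    Matrix.cons_val_one, Sum.elim_inl, Sum.elim_inr, Function.comp_apply] at hb hy hz
  have hab : a = b := Subtype.ext (funext fun i => I.inM_injective (hb i))
  rw [hab, I.inX_injective hy, ← hz]
  exact hd ()

/-- A given representative of `g` need not lie in `N'`, but `act(·, x, g • x)` has a solution, hence
one with entries in `N'`. -/
theorem exists_mem_groupPoints {x : X} (hx : I.inX x ∈ N') {g : I.Carrier M}
    (hg : I.inX (g • x) ∈ N') :
    ∃ g' ∈ I.groupPoints (I.traceM (N' : Set (I.Pair M X))), g • x = g' • x := by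
  obtain ⟨a, rfl⟩ := I.cls_surjective g
  obtain ⟨d, hd, h⟩ := N'.exists_realize (γ := Fin 2) (δ := Fin I.n)
    (z := ![I.inX x, I.inX (I.cls a • x)]) (d := I.inM ∘ a.1)
    (Relations.formula (L := I.pairLanguage) PairRel.act
      fun i => Term.var (Fin.append .inr .inl i))
    (by intro i; fin_cases i; exacts [hx, hg])
    (Formula.realize_rel.2 ((I.relMap_act_iff _).2 ⟨a, x, by simp⟩))
  obtain ⟨b, y, hb, hy, hz⟩ := (I.relMap_act_iff _).1 (Formula.realize_rel.1 h)
  simp only [Term.realize_var, Fin.append_left, Fin.append_right, Matrix.cons_val_zero,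
    Matrix.cons_val_one, Sum.elim_inl, Sum.elim_inr] at hb hy hz
  refine ⟨I.cls b, ⟨b, fun i => ?_, rfl⟩, ?_⟩
  · show I.inM (b.1 i) ∈ N'
    exact hb i ▸ hd i
  · rw [I.inX_injective hz, ← I.inX_injective hy]

theorem autAction_groupPoints {A : Set M} {f : Aut L M} (hf : f ∈ fixing L M A) {g : I.Carrier M}
    (hg : g ∈ I.groupPoints A) : I.autAction M f g = g := by
  obtain ⟨a, ha, rfl⟩ := hg
  rw [autAction_cls]
  exact congrArg I.cls (Subtype.ext (funext fun i => hf _ (ha i)))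

variable [IsAffineCopy (I.Carrier M) X] (x₀ : X)

theorem exists_smul_mem : ∃ h₀ : I.Carrier M, I.inX (h₀ • x₀) ∈ N' := by
  have : Nonempty X := ⟨x₀⟩
  obtain ⟨x, hx⟩ := I.exists_inX_mem N'
  exact ⟨I.coord x₀ x, by simpa using hx⟩

variable {x₀} in
theorem inX_mem_iff {h₀ : I.Carrier M} (h : I.inX (h₀ • x₀) ∈ N') (x : X) :
    I.inX x ∈ N' ↔
      ∃ g ∈ I.groupPoints (I.traceM (N' : Set (I.Pair M X))), x = g • h₀ • x₀ := by
  constructor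
  · intro hx
    rw [← I.coord_smul (M := M) (h₀ • x₀) x] at hx ⊢
    exact I.exists_mem_groupPoints N' h hx
  · rintro ⟨_, ⟨a, ha, rfl⟩, rfl⟩
    exact I.inX_smul_mem N' ha h

/-- The conjugate is the lift of `f` with respect to the base point `h₀ • x₀`: it sends `g • h₀ •
x₀` to `f(g) • h₀ • x₀`, and `f(g) = g`. -/
theorem conj_liftAut_inX {A : Set M} {f : Aut L M} (hf : f ∈ fixing L M A) {g : I.Carrier M}
    (hg : g ∈ I.groupPoints A) (h₀ : I.Carrier M) :
    ((I.liftGroup x₀ h₀)⁻¹ * I.liftAut x₀ f * I.liftGroup x₀ h₀) (I.inX (g • h₀ • x₀)) =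
      I.inX (g • h₀ • x₀) := by
  rw [conj_liftAut_eq, aut_mul_apply, ← mul_smul, liftAut_inX, liftGroup_inX, map_mul,
    I.autAction_groupPoints hf hg]
  group

variable {x₀} in
theorem mem_fixing_iff {h₀ : I.Carrier M} (h : I.inX (h₀ • x₀) ∈ N')
    (F : Aut I.pairLanguage (I.Pair M X)) :
    F ∈ fixing I.pairLanguage (I.Pair M X) (N' : Set (I.Pair M X)) ↔
      ∃ f ∈ fixing L M (I.traceM (N' : Set (I.Pair M X))),
        F = (I.liftGroup x₀ h₀)⁻¹ * I.liftAut x₀ f * I.liftGroup x₀ h₀ := by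
  constructor
  · intro hF
    obtain ⟨f, hf⟩ := I.exists_restriction F
    have hf' : f ∈ fixing L M (I.traceM (N' : Set (I.Pair M X))) := fun m hm =>
      I.inM_injective (X := X) ((hf m).symm.trans (hF _ hm))
    refine ⟨f, hf', I.pairAut_ext (h₀ • x₀) (fun m => ?_) ?_⟩
    · rw [conj_liftAut_eq, lift_inM, hf]
    -- The base point `h₀ • x₀` lies in `N'` and is fixed by both sides, so agreement on `M`
    -- suffices.
    · obtain ⟨g, hg, e⟩ := (I.inX_mem_iff N' h _).1 h
      rw [hF _ h, e, I.conj_liftAut_inX x₀ hf' hg]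
  · rintro ⟨f, hf, rfl⟩ c hc
    rcases I.pair_cases c with ⟨m, rfl⟩ | ⟨x, rfl⟩
    · rw [conj_liftAut_eq, lift_inM, hf m hc]
    · obtain ⟨g, hg, rfl⟩ := (I.inX_mem_iff N' h _).1 hc
      exact I.conj_liftAut_inX x₀ hf hg h₀

end ElementarySubstructures

end GroupFormulas

end AffineCopy

/-! ### Definability of `M` in `N` -/

namespace AffineCopy

/-- The last bound variable, separated from the other variables. -/
def splitLast (α : Type*) (k : ℕ) : α ⊕ Fin (k + 1) → (α ⊕ Fin k) ⊕ Unit :=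
  Sum.elim (Sum.inl ∘ Sum.inl) (Fin.snoc (Sum.inl ∘ Sum.inr) (Sum.inr ()))

theorem elim_comp_splitLast {α N : Type*} {k : ℕ} (c : α ⊕ Fin k → N) (u : Unit → N) :
    Sum.elim c u ∘ splitLast α k =
      Sum.elim (c ∘ Sum.inl) (Fin.snoc (c ∘ Sum.inr) (u ()) : Fin (k + 1) → N) := by
  funext i
  rcases i with i | i
  · rfl
  · induction i using Fin.lastCases <;> simp [splitLast]

namespace GroupFormulas

variable {L : FirstOrder.Language.{u, v}} (I : GroupFormulas L)
variable (M : Type w) (X : Type w') [L.Structure M] [I.IsGroup M] [MulAction (I.Carrier M) X]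

/-- The formula that defines the sort `X`. -/
def sortXFormula {γ : Type*} (i : γ) : I.pairLanguage.Formula γ :=
  Relations.formula (L := I.pairLanguage) PairRel.sortX fun _ => Term.var i

variable {M X} in
theorem realize_sortXFormula {γ : Type*} (i : γ) (d : γ → I.Pair M X) :
    (I.sortXFormula i).Realize d ↔ ∃ x, d i = I.inX x :=
  Formula.realize_rel.trans (I.relMap_sortX _)

variable {M} in
/-- The graph of an `L`-term on the sort `M` is definable in `(M, X, ·)`. -/
theorem exists_formula_of_term {α : Type*} (t : L.Term α) :
    ∃ ψ : I.pairLanguage.Formula (α ⊕ Unit), ∀ (z : α → M) (c : I.Pair M X),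
      ψ.Realize (Sum.elim (I.inM ∘ z) fun _ => c) ↔ c = I.inM (t.realize z) := by
  induction t with
  | var i =>
    refine ⟨Term.equal (.var (.inr ())) (.var (.inl i)), fun z c => ?_⟩
    simp [Formula.realize_equal]
  | @func k f ts ih =>
    choose ψ hψ using ih
    -- Without function symbols a compound term is unfolded: the values of its arguments are
    -- quantified, each pinned by its own formula, and tied to `c` by the graph of `f`.
    let graph : I.pairLanguage.Formula ((α ⊕ Unit) ⊕ Fin k) :=
      Relations.formula (L := I.pairLanguage) (PairRel.graph f)
        fun i => Term.var (Fin.snoc (α := fun _ => (α ⊕ Unit) ⊕ Fin k) .inr (.inl (.inr ())) i)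
    let arg (i : Fin k) : I.pairLanguage.Formula ((α ⊕ Unit) ⊕ Fin k) :=
      (ψ i).relabel (Sum.elim (.inl ∘ .inl) fun _ => .inr i)
    refine ⟨(Formula.iInf arg ⊓ graph).iExs (Fin k), fun z c => ?_⟩
    have harg (i : Fin k) (d : Fin k → I.Pair M X) :
        (arg i).Realize (Sum.elim (Sum.elim (I.inM ∘ z) fun _ => c) d) ↔
          d i = I.inM ((ts i).realize z) := by
      rw [← hψ, Formula.realize_relabel, Sum.comp_elim]
      rfl
    have hgraph (d : Fin k → I.Pair M X) :
        graph.Realize (Sum.elim (Sum.elim (I.inM ∘ z) fun _ => c) d) ↔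
          Structure.RelMap (L := I.pairLanguage) (PairRel.graph f)
            (Fin.snoc d c : Fin (k + 1) → I.Pair M X) := by
      refine Formula.realize_rel.trans (iff_of_eq (congrArg _ ?_))
      funext i
      induction i using Fin.lastCases <;> simp
    simp only [Formula.realize_iExs, Formula.realize_inf, Formula.realize_iInf, harg, hgraph]
    constructor
    · rintro ⟨d, hd, a, ha⟩
      have h1 : ∀ i, a i = (ts i).realize z := fun i => by
        have h := congrFun ha i.castSucc
        simp only [Fin.snoc_castSucc, Function.comp_apply] at h
        exact I.inM_injective (h.symm.trans (hd i))
      have h2 := congrFun ha (Fin.last k)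
      simp only [Fin.snoc_last, Function.comp_apply] at h2
      rw [h2, Term.realize_func, funext h1]
    · rintro rfl
      refine ⟨fun i => I.inM ((ts i).realize z), fun _ => rfl, fun i => (ts i).realize z, ?_⟩
      rw [Fin.comp_snoc]
      rfl

variable {M} in
/-- `L`-definable relations on the sort `M` are definable in `(M, X, ·)`. -/
theorem exists_pairFormula {α : Type*} {k : ℕ} (φ : L.BoundedFormula α k) :
    ∃ ψ : I.pairLanguage.Formula (α ⊕ Fin k), ∀ z : α ⊕ Fin k → M,
      ψ.Realize (I.inM ∘ z : _ → I.Pair M X) ↔ φ.Realize (z ∘ Sum.inl) (z ∘ Sum.inr) := by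
  induction φ with
  | falsum => exact ⟨⊥, fun _ => Iff.rfl⟩
  | equal t₁ t₂ =>
    obtain ⟨ψ₁, h₁⟩ := I.exists_formula_of_term (M := M) X t₁
    obtain ⟨ψ₂, h₂⟩ := I.exists_formula_of_term (M := M) X t₂
    refine ⟨(ψ₁ ⊓ ψ₂).iExs Unit, fun z => ?_⟩
    simp only [Formula.realize_iExs, Formula.realize_inf]
    have h := fun d : Unit → I.Pair M X => and_congr (h₁ z (d ())) (h₂ z (d ()))
    refine (exists_congr h).trans ?_
    simp only [BoundedFormula.Realize, Sum.elim_comp_inl_inr]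
    constructor
    · rintro ⟨d, h1, h2⟩
      exact I.inM_injective (h1.symm.trans h2)
    · intro h
      exact ⟨fun _ => I.inM (t₁.realize z), rfl, congrArg I.inM h⟩
  | @rel n l R ts =>
    choose ψ hψ using fun i => I.exists_formula_of_term (M := M) X (ts i)
    let rel : I.pairLanguage.Formula ((α ⊕ Fin n) ⊕ Fin l) :=
      Relations.formula (L := I.pairLanguage) (PairRel.rel R) fun i => Term.var (.inr i)
    let arg (i : Fin l) : I.pairLanguage.Formula ((α ⊕ Fin n) ⊕ Fin l) :=
      (ψ i).relabel (Sum.elim .inl fun _ => .inr i)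
    refine ⟨(Formula.iInf arg ⊓ rel).iExs (Fin l), fun z => ?_⟩
    have harg (i : Fin l) (d : Fin l → I.Pair M X) :
        (arg i).Realize (Sum.elim (I.inM ∘ z) d) ↔ d i = I.inM ((ts i).realize z) := by
      rw [← hψ, Formula.realize_relabel, Sum.comp_elim]
      rfl
    simp only [Formula.realize_iExs, Formula.realize_inf, Formula.realize_iInf, harg,
      BoundedFormula.Realize, Sum.elim_comp_inl_inr]
    rw [← I.relMap_rel (X := X)]
    constructor
    · rintro ⟨d, hd, h⟩
      obtain rfl := funext hd
      exact h
    · intro h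
      exact ⟨_, fun _ => rfl, h⟩
  | imp φ₁ φ₂ ih₁ ih₂ =>
    obtain ⟨ψ₁, h₁⟩ := ih₁
    obtain ⟨ψ₂, h₂⟩ := ih₂
    exact ⟨ψ₁.imp ψ₂, fun z => by rw [Formula.realize_imp, h₁, h₂, BoundedFormula.realize_imp]⟩
  | @all n φ ih =>
    obtain ⟨ψ, hψ⟩ := ih
    let sortX : I.pairLanguage.Formula ((α ⊕ Fin n) ⊕ Unit) := I.sortXFormula (.inr ())
    -- The quantifier is relativized to `M`: an element of the sort `X` satisfies the first
    -- disjunct.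
    refine ⟨(sortX ⊔ ψ.relabel (splitLast α n)).iAlls Unit, fun z => ?_⟩
    have hX (d : Unit → I.Pair M X) :
        sortX.Realize (Sum.elim (I.inM ∘ z) d) ↔ ∃ x, d () = I.inX x :=
      I.realize_sortXFormula _ _
    have hM (m : M) : (ψ.relabel (splitLast α n)).Realize
        (Sum.elim (I.inM ∘ z) fun _ => I.inM m : _ → I.Pair M X) ↔
          φ.Realize (z ∘ Sum.inl) (Fin.snoc (z ∘ Sum.inr) m) := by
      have h := hψ (Sum.elim z (fun _ => m) ∘ splitLast α n)
      rw [← Function.comp_assoc, Sum.comp_elim] at h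
      rw [Formula.realize_relabel]
      refine h.trans ?_
      rw [elim_comp_splitLast]
      rfl
    simp only [Formula.realize_iAlls, Formula.realize_sup, hX, BoundedFormula.realize_all, ← hM]
    constructor
    · intro h m
      rcases h fun _ => I.inM m with ⟨x, hx⟩ | h
      · exact (I.inM_ne_inX m x hx).elim
      · exact h
    · intro h d
      rcases I.pair_cases (d ()) with ⟨m, hm⟩ | hx
      · right
        obtain rfl : d = fun _ => I.inM m := funext fun _ => hm
        exact h m
      · exact .inl hx

variable {M X}

/-- The trace on `M` of an elementary substructure of `(M, X, ·)` is an elementary substructure. -/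
theorem exists_elementary_traceM (N' : I.pairLanguage.ElementarySubstructure (I.Pair M X)) :
    ∃ S : L.ElementarySubstructure M,
      (S : Set M) = I.traceM (N' : Set (I.Pair M X)) := by
  -- Adding "not of sort `X`" to the formula forces the witness found in `N'` to lie in `M`.
  have hwitness {γ : Type} (ψ : I.pairLanguage.Formula (γ ⊕ Unit)) {z : γ → M}
      (hz : ∀ i, I.inM (z i) ∈ N') {m : M}
      (h : ψ.Realize (Sum.elim (I.inM ∘ z) fun _ => I.inM m : _ → I.Pair M X)) :
      ∃ m' : M, I.inM m' ∈ N' ∧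
        ψ.Realize (Sum.elim (I.inM ∘ z) fun _ => I.inM m' : _ → I.Pair M X) := by
    let sortX : I.pairLanguage.Formula (γ ⊕ Unit) := I.sortXFormula (.inr ())
    have hX (d : Unit → I.Pair M X) :
        sortX.Realize (Sum.elim (I.inM ∘ z) d) ↔ ∃ x, d () = I.inX x :=
      I.realize_sortXFormula _ _
    obtain ⟨d, hd, h'⟩ := N'.exists_realize (ψ ⊓ sortX.not) (z := I.inM ∘ z) hz
      (d := fun _ => I.inM m) (by
        rw [Formula.realize_inf, Formula.realize_not, hX]
        exact ⟨h, fun ⟨x, hx⟩ => I.inM_ne_inX m x hx⟩)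
    rw [Formula.realize_inf, Formula.realize_not, hX] at h'
    rcases I.pair_cases (d ()) with ⟨m', hm'⟩ | hx
    · obtain rfl : d = fun _ => I.inM m' := funext fun _ => hm'
      exact ⟨m', hd (), h'.1⟩
    · exact (h'.2 hx).elim
  let S : L.Substructure M :=
    { carrier := I.traceM (N' : Set (I.Pair M X))
      fun_mem := fun {k} f a ha => by
        -- Closure under `f`: the value `f(a)` is the unique witness of its graph formula.
        obtain ⟨ψ, hψ⟩ := I.exists_formula_of_term (M := M) X (Term.func f (Term.var : Fin k → _))
        obtain ⟨m, hm, h⟩ := hwitness ψ (z := a) ha ((hψ a _).2 rfl)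
        have e := (hψ a _).1 h
        rw [e] at hm
        exact hm }
  refine ⟨S.toElementarySubstructure fun k φ x a h => ?_, rfl⟩
  -- The Tarski–Vaught test: translate the formula to `N`, find a witness in `N'`, translate back.
  obtain ⟨ψ, hψ⟩ := I.exists_pairFormula X (M := M) φ
  have key (m : M) : (ψ.relabel (splitLast Empty k)).Realize
      (Sum.elim (I.inM ∘ Sum.elim Empty.elim ((↑) ∘ x)) fun _ => I.inM m : _ → I.Pair M X) ↔
        φ.Realize default (Fin.snoc ((↑) ∘ x) m : _ → M) := by
    have h := hψ (Sum.elim (Sum.elim Empty.elim ((↑) ∘ x)) (fun _ => m) ∘ splitLast Empty k)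
    rw [← Function.comp_assoc, Sum.comp_elim] at h
    rw [Formula.realize_relabel]
    refine h.trans ?_
    rw [elim_comp_splitLast]
    exact iff_of_eq (congrArg₂ _ (Subsingleton.elim _ _) rfl)
  obtain ⟨m, hm, h'⟩ := hwitness _ (by rintro (i | i); exacts [i.elim, (x i).2]) ((key a).2 h)
  exact ⟨⟨m, hm⟩, (key m).1 h'⟩

end GroupFormulas

end AffineCopy

/-! ### Coding `N` in `M` over the base point -/

namespace AffineCopy

namespace GroupFormulas

variable {L : FirstOrder.Language.{u, v}} (I : GroupFormulas L)
variable {M : Type w} {X : Type w'} [L.Structure M] [I.IsGroup M] [MulAction (I.Carrier M) X]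

/-- The tuple `z` of elements of `M` codes the element `c` of `(M, X, ·)`: the component `none` is an
element of the sort `M`, the other components represent the element of `G` that moves the base point
to an element of the sort `X`. -/
def Codes (x₀ : X) : Bool → (Option (Fin I.n) → M) → I.Pair M X → Prop
  | false, z, c => c = I.inM (z none)
  | true, z, c => ∃ h : I.dom.Realize (z ∘ some), c = I.inX (I.cls ⟨z ∘ some, h⟩ • x₀)

/-- The formula that defines the codes of elements of the given sort. -/
def codeFormula : Bool → L.Formula (Option (Fin I.n))
  | false => ⊤
  | true => I.dom.relabel some

variable (x₀ : X)

theorem realize_codeFormula (t : Bool) (z : Option (Fin I.n) → M) :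
    (I.codeFormula t).Realize z ↔ ∃ c, I.Codes x₀ t z c := by
  cases t
  · exact ⟨fun _ => ⟨_, rfl⟩, fun _ => Formula.realize_top.2 trivial⟩
  · exact Formula.realize_relabel.trans ⟨fun h => ⟨_, h, rfl⟩, fun ⟨_, h, _⟩ => h⟩

variable {x₀} in
theorem Codes.ne_inX {z : Option (Fin I.n) → M} {c : I.Pair M X} (h : I.Codes x₀ false z c) (x : X) :
    c ≠ I.inX x := fun e => I.inM_ne_inX _ _ (h.symm.trans e)

variable {x₀} in
theorem Codes.ne_inM {z : Option (Fin I.n) → M} {c : I.Pair M X} (h : I.Codes x₀ true z c) (m : M) :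
    c ≠ I.inM m := fun e => I.inM_ne_inX _ _ (e.symm.trans h.2)

/-- The position of the coordinates of a code in a formula, where the code of the last bound variable
is separated from the other codes. -/
def splitCode (α : Type*) (k : ℕ) (J : Type*) (q : (α ⊕ Fin (k + 1)) × J) :
    ((α ⊕ Fin k) × J) ⊕ J :=
  Sum.map (·, q.2) (fun _ => q.2) (splitLast α k q.1)

variable {x₀} in
theorem codes_splitCode {α : Type*} {k : ℕ} {s : α ⊕ Fin k → Bool} {t : Bool}
    {z : (α ⊕ Fin k) × Option (Fin I.n) → M} {y : Option (Fin I.n) → M}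
    {c : α ⊕ Fin k → I.Pair M X} {d : I.Pair M X}
    (hc : ∀ i, I.Codes x₀ (s i) (fun o => z (i, o)) (c i)) (hd : I.Codes x₀ t y d)
    (i : α ⊕ Fin (k + 1)) :
    I.Codes x₀ ((Sum.elim s (fun _ => t) ∘ splitLast α k) i)
      (fun o => (Sum.elim z y ∘ splitCode α k _) (i, o))
      ((Sum.elim c (fun _ => d) ∘ splitLast α k) i) := by
  simp only [Function.comp_apply, splitCode]
  rcases splitLast α k i with j | j
  exacts [hc j, hd]

/-- A code in the sort `X` does not use its component `none`; nonemptiness of `A` serves to fill it.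
-/
theorem exists_codes {A : Set M} (hA : A.Nonempty) {c : I.Pair M X}
    (hc : (∃ m ∈ A, c = I.inM m) ∨ ∃ g ∈ I.groupPoints A, c = I.inX (g • x₀)) :
    ∃ t z, (∀ i, z i ∈ A) ∧ I.Codes x₀ t z c := by
  rcases hc with ⟨m, hm, rfl⟩ | ⟨_, ⟨a, ha, rfl⟩, rfl⟩
  · exact ⟨false, fun _ => m, fun _ => hm, rfl⟩
  · obtain ⟨m, hm⟩ := hA
    refine ⟨true, fun o => o.elim m a.1, ?_, a.2, rfl⟩
    rintro (- | i)
    exacts [hm, ha i]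

variable {x₀} in
theorem Codes.mem {A : Set M} {t : Bool} {z : Option (Fin I.n) → M} {c : I.Pair M X}
    (h : I.Codes x₀ t z c) (hz : ∀ i, z i ∈ A) :
    (∃ m ∈ A, c = I.inM m) ∨ ∃ g ∈ I.groupPoints A, c = I.inX (g • x₀) := by
  cases t
  · exact .inl ⟨_, hz none, h⟩
  · exact .inr ⟨_, ⟨⟨_, h.1⟩, fun i => hz (some i), rfl⟩, h.2⟩

variable [IsAffineCopy (I.Carrier M) X]

/-- The relations of `(M, X, ·)` are definable in `M` in terms of codes. -/
theorem exists_formula_of_pairRel {k : ℕ} (R : I.PairRel k) (s : Fin k → Bool) :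
    ∃ ψ : L.Formula (Fin k × Option (Fin I.n)),
      ∀ (z : Fin k × Option (Fin I.n) → M) (c : Fin k → I.Pair M X),
        (∀ i, I.Codes x₀ (s i) (fun o => z (i, o)) (c i)) →
          (ψ.Realize z ↔ Structure.RelMap (L := I.pairLanguage) R c) := by
  have hM {k : ℕ} {s : Fin k → Bool} (hs : ∀ i, s i = false) {z : Fin k × Option (Fin I.n) → M}
      {c : Fin k → I.Pair M X} (hc : ∀ i, I.Codes x₀ (s i) (fun o => z (i, o)) (c i)) :
      c = I.inM ∘ fun i => z (i, none) := funext fun i => by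
    have h := hc i
    rw [hs i] at h
    exact h
  have hX {k : ℕ} {s : Fin k → Bool} (hs : ¬ ∀ i, s i = false) {z : Fin k × Option (Fin I.n) → M}
      {c : Fin k → I.Pair M X} (hc : ∀ i, I.Codes x₀ (s i) (fun o => z (i, o)) (c i))
      (a : Fin k → M) : c ≠ I.inM ∘ a := by
    obtain ⟨i, hi⟩ := not_forall.1 hs
    have h := hc i
    rw [Bool.eq_true_of_not_eq_false hi] at h
    exact fun e => h.ne_inM I (a i) (congrFun e i)
  cases R with
  | rel R =>
    by_cases hs : ∀ i, s i = false
    · refine ⟨R.formula fun i => Term.var (i, none), fun z c hc => ?_⟩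
      rw [hM hs hc]
      exact Formula.realize_rel.trans (I.relMap_rel R _).symm
    -- A relation that lives on `M` fails as soon as one argument has sort `X`.
    · exact ⟨⊥, fun z c hc => ⟨False.elim, fun ⟨a, ha, _⟩ => hX hs hc a ha⟩⟩
  | @graph k f =>
    by_cases hs : ∀ i, s i = false
    · refine ⟨(Term.var (Fin.last k, none)).equal
        (Term.func f fun i => Term.var (i.castSucc, none)), fun z c hc => ?_⟩
      rw [hM hs hc]
      exact Formula.realize_equal.trans (I.relMap_graph (X := X) f fun i => z (i, none)).symm
    · exact ⟨⊥, fun z c hc => ⟨False.elim, fun ⟨a, ha⟩ => hX hs hc _ ha⟩⟩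
  | sortX =>
    cases hs : s 0
    · refine ⟨⊥, fun z c hc => ⟨False.elim, fun ⟨x, hx⟩ => ?_⟩⟩
      have h := hc 0
      rw [hs] at h
      exact h.ne_inX I x (congrFun hx 0)
    · refine ⟨⊤, fun z c hc => ⟨fun _ => (I.relMap_sortX _).2 ?_, fun _ => Formula.realize_top.2 trivial⟩⟩
      have h := hc 0
      rw [hs] at h
      exact ⟨_, h.2⟩
  | act =>
    by_cases hs : (∀ i, s (Fin.castAdd 2 i) = false) ∧ s (Fin.natAdd I.n 0) = true ∧
      s (Fin.natAdd I.n 1) = true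
    · obtain ⟨hs, hs₀, hs₁⟩ := hs
      let p (i : Fin I.n) : Fin (I.n + 2) × Option (Fin I.n) := (Fin.castAdd 2 i, none)
      let q (j : Fin 2) (i : Fin I.n) : Fin (I.n + 2) × Option (Fin I.n) :=
        (Fin.natAdd I.n j, some i)
      -- By freeness `[a] • [b] • x₀ = [d] • x₀` means `[a] * [b] = [d]`, which `mul` expresses. The
      -- condition `dom` is imposed on `a` only, because the codes `b` and `d` already satisfy it.
      refine ⟨I.dom.relabel p ⊓ I.mul.relabel (Sum.elim p (Sum.elim (q 0) (q 1))),
        fun z c hc => ?_⟩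
      have ha (i : Fin I.n) : c (Fin.castAdd 2 i) = I.inM (z (p i)) := by
        have h := hc (Fin.castAdd 2 i)
        rw [hs i] at h
        exact h
      have h₀ := hc (Fin.natAdd I.n 0)
      have h₁ := hc (Fin.natAdd I.n 1)
      rw [hs₀] at h₀
      rw [hs₁] at h₁
      obtain ⟨hb, hb'⟩ := h₀
      obtain ⟨hd, hd'⟩ := h₁
      rw [relMap_act_iff, hb', hd', Formula.realize_inf, Formula.realize_relabel,
        Formula.realize_relabel, Sum.comp_elim, Sum.comp_elim]
      constructor
      · rintro ⟨h, hm⟩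
        refine ⟨⟨_, h⟩, _, ha, rfl, ?_⟩
        rw [← mul_smul, (I.cls_mul_cls (a := ⟨_, h⟩) (b := ⟨_, hb⟩) (c := ⟨_, hd⟩)).2 hm]
      · rintro ⟨a, x, hza, hx, hy⟩
        have e : z ∘ p = a.1 := funext fun i => I.inM_injective ((ha i).symm.trans (hza i))
        rw [e]
        refine ⟨a.2, ?_⟩
        rw [← I.inX_injective hx, ← mul_smul] at hy
        exact (I.cls_mul_cls (a := a) (b := ⟨_, hb⟩) (c := ⟨_, hd⟩)).1
          (I.smul_inj x₀ (I.inX_injective hy)).symm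
    · refine ⟨⊥, fun z c hc => ⟨False.elim, fun h => hs ?_⟩⟩
      obtain ⟨a, x, ha, hx, hy⟩ := (I.relMap_act_iff c).1 h
      have hsort {i : Fin (I.n + 2)} {x : X} (h : c i = I.inX x) : s i = true := by
        have h' := hc i
        cases e : s i
        · rw [e] at h'
          exact (h'.ne_inX I _ h).elim
        · rfl
      refine ⟨fun i => ?_, hsort hx, hsort hy⟩
      have h' := hc (Fin.castAdd 2 i)
      cases e : s (Fin.castAdd 2 i)
      · rfl
      · rw [e] at h'
        exact (h'.ne_inM I _ (ha i)).elim

theorem mem_univ_points (c : I.Pair M X) :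
    (∃ m ∈ (Set.univ : Set M), c = I.inM m) ∨
      ∃ g ∈ I.groupPoints (Set.univ : Set M), c = I.inX (g • x₀) := by
  rcases I.pair_cases c with ⟨m, rfl⟩ | ⟨x, rfl⟩
  · exact .inl ⟨m, trivial, rfl⟩
  · obtain ⟨a, ha⟩ := I.cls_surjective (I.coord x₀ x : I.Carrier M)
    exact .inr ⟨_, ⟨a, fun _ => trivial, rfl⟩, by rw [ha, I.coord_smul]⟩

/-- Relations that are definable in `(M, X, ·)` are definable in `M` in terms of codes. -/
theorem exists_formula_of_pairFormula [Nonempty M] {α : Type*} {k : ℕ}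
    (φ : I.pairLanguage.BoundedFormula α k) (s : α ⊕ Fin k → Bool) :
    ∃ ψ : L.Formula ((α ⊕ Fin k) × Option (Fin I.n)),
      ∀ (z : (α ⊕ Fin k) × Option (Fin I.n) → M) (c : α ⊕ Fin k → I.Pair M X),
        (∀ i, I.Codes x₀ (s i) (fun o => z (i, o)) (c i)) →
          (ψ.Realize z ↔ φ.Realize (c ∘ Sum.inl) (c ∘ Sum.inr)) := by
  -- The language of `N` has no function symbols, so its terms are variables.
  have hvar {β : Type _} (t : I.pairLanguage.Term β) : ∃ i, t = Term.var i := by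
    cases t with
    | var i => exact ⟨i, rfl⟩
    | func f => exact f.elim
  induction φ with
  | falsum => exact ⟨⊥, fun _ _ _ => Iff.rfl⟩
  | equal t₁ t₂ =>
    obtain ⟨i, rfl⟩ := hvar t₁
    obtain ⟨j, rfl⟩ := hvar t₂
    simp only [BoundedFormula.Realize, Sum.elim_comp_inl_inr, Term.realize_var]
    cases hi : s i <;> cases hj : s j
    · refine ⟨(Term.var (i, none)).equal (Term.var (j, none)), fun z c hc => ?_⟩
      have h1 := hc i
      have h2 := hc j
      rw [hi] at h1
      rw [hj] at h2
      rw [Formula.realize_equal, h1, h2, I.inM_injective.eq_iff]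
      rfl
    · refine ⟨⊥, fun z c hc => ⟨False.elim, fun e => ?_⟩⟩
      have h1 := hc i
      have h2 := hc j
      rw [hi] at h1
      rw [hj] at h2
      exact h1.ne_inX I _ (e.trans h2.2)
    · refine ⟨⊥, fun z c hc => ⟨False.elim, fun e => ?_⟩⟩
      have h1 := hc i
      have h2 := hc j
      rw [hi] at h1
      rw [hj] at h2
      exact h1.ne_inM I _ (e.trans h2)
    -- By freeness, equality of points of `X` is equality of the coded group elements.
    · refine ⟨I.eqv.relabel (Sum.elim (fun o => (i, some o)) fun o => (j, some o)),
        fun z c hc => ?_⟩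
      have h1 := hc i
      have h2 := hc j
      rw [hi] at h1
      rw [hj] at h2
      rw [h1.2, h2.2, I.inX_injective.eq_iff, Formula.realize_relabel, Sum.comp_elim]
      exact (I.cls_eq_cls (a := ⟨_, h1.1⟩) (b := ⟨_, h2.1⟩)).symm.trans
        ⟨fun e => by rw [e], I.smul_inj x₀⟩
  | @rel n l R ts =>
    choose i hi using fun j => hvar (ts j)
    obtain ⟨ψ, hψ⟩ := I.exists_formula_of_pairRel (M := M) x₀ R (s ∘ i)
    refine ⟨ψ.relabel (Prod.map i id), fun z c hc => ?_⟩
    rw [Formula.realize_relabel, hψ (z ∘ Prod.map i id) (c ∘ i) fun j => hc (i j)]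
    simp only [BoundedFormula.Realize, Sum.elim_comp_inl_inr, hi, Term.realize_var]
    rfl
  | imp φ₁ φ₂ ih₁ ih₂ =>
    obtain ⟨ψ₁, h₁⟩ := ih₁ s
    obtain ⟨ψ₂, h₂⟩ := ih₂ s
    exact ⟨ψ₁.imp ψ₂, fun z c hc => by
      rw [Formula.realize_imp, h₁ z c hc, h₂ z c hc, BoundedFormula.realize_imp]⟩
  | @all n φ ih =>
    choose ψ hψ using fun t : Bool => ih (Sum.elim s (fun _ => t) ∘ splitLast α n)
    -- The translation depends on the sort of each variable. A quantifier over `N` thus becomes a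
    -- conjunction over the two sorts of quantifiers over codes of that sort.
    refine ⟨(Formula.iInf fun t => ((I.codeFormula t).relabel Sum.inr).imp
      ((ψ t).relabel (splitCode α n _))).iAlls (Option (Fin I.n)), fun z c hc => ?_⟩
    have key {t : Bool} {y : Option (Fin I.n) → M} {d : I.Pair M X} (hd : I.Codes x₀ t y d) :
        ((ψ t).relabel (splitCode α n _)).Realize (Sum.elim z y) ↔
          φ.Realize (c ∘ Sum.inl) (Fin.snoc (c ∘ Sum.inr) d) := by
      rw [Formula.realize_relabel, hψ t _ _ (I.codes_splitCode hc hd), elim_comp_splitLast]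
      rfl
    simp only [Formula.realize_iAlls, Formula.realize_iInf, Formula.realize_imp,
      BoundedFormula.realize_all]
    constructor
    · intro h d
      obtain ⟨t, y, -, hd⟩ := I.exists_codes x₀ Set.univ_nonempty (I.mem_univ_points x₀ d)
      refine (key hd).1 (h y t ?_)
      rw [Formula.realize_relabel, Sum.elim_comp_inr]
      exact (I.realize_codeFormula x₀ t y).2 ⟨d, hd⟩
    · intro h y t ht
      rw [Formula.realize_relabel, Sum.elim_comp_inr, I.realize_codeFormula x₀] at ht
      obtain ⟨d, hd⟩ := ht
      exact (key hd).2 (h d)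

/-- If `S` is an elementary substructure of `M`, then `(S, G(S) · x₀)` is an elementary substructure
of `(M, X, ·)`. -/
theorem exists_elementary_pair (S : L.ElementarySubstructure M) :
    ∃ N' : I.pairLanguage.ElementarySubstructure (I.Pair M X), ∀ c ∈ N',
      (∃ m ∈ (S : Set M), c = I.inM m) ∨ ∃ g ∈ I.groupPoints (S : Set M), c = I.inX (g • x₀) := by
  -- If `M` is empty, there is nothing to fill unused components of codes with, but then `S` is all
  -- of `M` and `N` itself serves.
  rcases isEmpty_or_nonempty M with hM | hM
  · refine ⟨⊤, fun c _ => ?_⟩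
    rw [Subsingleton.elim (S : Set M) Set.univ]
    exact I.mem_univ_points x₀ c
  have hS : (S : Set M).Nonempty := Set.nonempty_coe_sort.1 (inferInstanceAs (Nonempty S))
  let N' : I.pairLanguage.Substructure (I.Pair M X) :=
    { carrier := {c | (∃ m ∈ (S : Set M), c = I.inM m) ∨
        ∃ g ∈ I.groupPoints (S : Set M), c = I.inX (g • x₀)}
      fun_mem := fun f => f.elim }
  refine ⟨N'.toElementarySubstructure fun k φ x a h => ?_, fun c hc => hc⟩
  choose s z hz hc using fun i => I.exists_codes x₀ hS (x i).2
  obtain ⟨t, y, -, ha⟩ := I.exists_codes x₀ Set.univ_nonempty (I.mem_univ_points x₀ a)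
  obtain ⟨ψ, hψ⟩ := I.exists_formula_of_pairFormula (M := M) x₀ φ
    (Sum.elim (Sum.elim Empty.elim s) (fun _ => t) ∘ splitLast Empty k)
  let z' : (Empty ⊕ Fin k) × Option (Fin I.n) → M :=
    fun q => (Sum.elim Empty.elim z : Empty ⊕ Fin k → Option (Fin I.n) → M) q.1 q.2
  have key {y : Option (Fin I.n) → M} {d : I.Pair M X} (hd : I.Codes x₀ t y d) :
      (ψ.relabel (splitCode Empty k _)).Realize (Sum.elim z' y) ↔
        φ.Realize default (Fin.snoc ((↑) ∘ x) d : _ → I.Pair M X) := by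
    rw [Formula.realize_relabel, hψ _ _ (I.codes_splitCode
      (c := Sum.elim Empty.elim ((↑) ∘ x)) (by rintro (i | i); exacts [i.elim, hc i]) hd),
      elim_comp_splitLast]
    exact iff_of_eq (congrArg₂ _ (Subsingleton.elim _ _) rfl)
  -- Tarski–Vaught through codes: the parameters have codes in `S`, so the translated formula has a
  -- solution in `S` that codes a point of the same sort `t`.
  obtain ⟨y', hy', h'⟩ := S.exists_realize
    ((I.codeFormula t).relabel Sum.inr ⊓ ψ.relabel (splitCode Empty k _)) (z := z') (d := y)
    (by rintro ⟨i | i, o⟩; exacts [i.elim, hz i o])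
    (by
      rw [Formula.realize_inf, Formula.realize_relabel, Sum.elim_comp_inr]
      exact ⟨(I.realize_codeFormula x₀ t y).2 ⟨a, ha⟩, (key ha).2 h⟩)
  rw [Formula.realize_inf, Formula.realize_relabel, Sum.elim_comp_inr,
    I.realize_codeFormula x₀] at h'
  obtain ⟨⟨d, hd⟩, h'⟩ := h'
  exact ⟨⟨d, hd.mem I hy'⟩, (key hd).1 h'⟩

end GroupFormulas

end AffineCopy

/-! ### Lascar strong automorphisms and the Lascar group -/

namespace AffineCopy

namespace GroupFormulas

variable {L : FirstOrder.Language.{u, v}} (I : GroupFormulas L)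
variable {M : Type w} {X : Type w'} [L.Structure M] [I.IsGroup M] [MulAction (I.Carrier M) X]
  [IsAffineCopy (I.Carrier M) X] (x₀ : X)

/-- Generators go to generators: if `f` fixes `S ≺ M`, then `f̄` fixes `(S, G(S) · x₀) ≺ N`. -/
theorem liftAut_mem_lascarStrong {f : Aut L M} (hf : f ∈ lascarStrong L M) :
    I.liftAut x₀ f ∈ lascarStrong I.pairLanguage (I.Pair M X) := by
  have hle : lascarStrong L M ≤
      (lascarStrong I.pairLanguage (I.Pair M X)).comap (I.liftAut x₀) := by
    refine (Subgroup.closure_le _).2 ?_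
    rintro f ⟨S, hS⟩
    obtain ⟨N', hN'⟩ := I.exists_elementary_pair x₀ S
    refine Subgroup.subset_closure ⟨N', fun c hc => ?_⟩
    rcases hN' c hc with ⟨m, hm, rfl⟩ | ⟨g, hg, rfl⟩
    · rw [liftAut_inM, hS m hm]
    · rw [liftAut_inX, I.autAction_groupPoints hS hg]
  exact hle hf

/-- By normality `h̄⁻¹ f̄ h̄ = (h⁻¹ f(h))‾ f̄` is Lascar strong along with `f̄`. Cancelling `f̄` and
inverting leaves the lift of the commutator `f(h)⁻¹ h`. -/
theorem liftGroup_mem_lascarStrong {g : I.Carrier M} (hg : g ∈ I.lascarSubgroup M) :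
    I.liftGroup x₀ g ∈ lascarStrong I.pairLanguage (I.Pair M X) := by
  have hle : I.lascarSubgroup M ≤
      (lascarStrong I.pairLanguage (I.Pair M X)).comap (I.liftGroup x₀) := by
    refine (Subgroup.closure_le _).2 ?_
    rintro _ ⟨_, h, ⟨f, hf, rfl⟩, rfl⟩
    have h1 := I.liftAut_mem_lascarStrong x₀ hf
    have h2 := lascarStrong_normal.conj_mem _ h1 (I.liftGroup x₀ h)⁻¹
    rw [inv_inv, conj_liftAut_eq] at h2
    have h3 := inv_mem ((Subgroup.mul_mem_cancel_right _ h1).1 h2)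
    rw [← map_inv, mul_inv_rev, inv_inv] at h3
    exact h3
  exact hle hg

/-- A generator is `h̄₀⁻¹ f̄ h̄₀` with `f` fixing the trace of `N'`, which is elementary in `M`.
Products and inverses stay of the required form because `G_L` is invariant under `Aut(M)`. -/
theorem exists_eq_lift_of_mem_lascarStrong {F : Aut I.pairLanguage (I.Pair M X)}
    (hF : F ∈ lascarStrong I.pairLanguage (I.Pair M X)) :
    ∃ g ∈ I.lascarSubgroup M, ∃ f ∈ lascarStrong L M,
      F = I.liftGroup x₀ g * I.liftAut x₀ f := by
  induction hF using Subgroup.closure_induction with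
  | mem F h =>
    obtain ⟨N', hN'⟩ := h
    obtain ⟨h₀, h⟩ := I.exists_smul_mem N' x₀
    obtain ⟨f, hf, rfl⟩ := (I.mem_fixing_iff N' h F).1 hN'
    obtain ⟨S, hS⟩ := I.exists_elementary_traceM N'
    have hf' : f ∈ lascarStrong L M := Subgroup.subset_closure ⟨S, hS ▸ hf⟩
    refine ⟨_, ?_, f, hf', I.conj_liftAut_eq x₀ h₀ f⟩
    -- The `G`-component `h₀⁻¹ f(h₀)` is the inverse of the generator `f(h₀)⁻¹ h₀` of `G_L`.
    have h1 := inv_mem (I.inv_mul_mem_lascarSubgroup hf' h₀)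
    rwa [mul_inv_rev, inv_inv] at h1
  | one => exact ⟨1, one_mem _, 1, one_mem _, by simp⟩
  | mul F F' _ _ hF hF' =>
    obtain ⟨g, hg, f, hf, rfl⟩ := hF
    obtain ⟨g', hg', f', hf', rfl⟩ := hF'
    refine ⟨_, mul_mem hg (I.autAction_mem_lascarSubgroup f hg'), _, mul_mem hf hf',
      I.lift_mul_lift x₀ g g' f f'⟩
  | inv F _ hF =>
    obtain ⟨g, hg, f, hf, rfl⟩ := hF
    refine ⟨_, I.autAction_mem_lascarSubgroup f⁻¹ (inv_mem hg), _, inv_mem hf, ?_⟩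
    rw [← liftAut_mul_liftGroup, mul_inv_rev, map_inv, map_inv]

theorem lift_mem_lascarStrong_iff (g : I.Carrier M) (f : Aut L M) :
    I.liftGroup x₀ g * I.liftAut x₀ f ∈ lascarStrong I.pairLanguage (I.Pair M X) ↔
      g ∈ I.lascarSubgroup M ∧ f ∈ lascarStrong L M := by
  constructor
  · intro h
    obtain ⟨g', hg, f', hf, e⟩ := I.exists_eq_lift_of_mem_lascarStrong x₀ h
    obtain ⟨rfl, rfl⟩ := I.lift_inj x₀ e
    exact ⟨hg, hf⟩
  · rintro ⟨hg, hf⟩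
    exact mul_mem (I.liftGroup_mem_lascarStrong x₀ hg) (I.liftAut_mem_lascarStrong x₀ hf)

/-- `Autf_L(N) = G_L ⋊ Autf_L(M)`. -/
noncomputable def lascarEquiv :
    I.lascarSubgroup M ⋊[I.lascarAction M] lascarStrong L M ≃*
      lascarStrong I.pairLanguage (I.Pair M X) :=
  MulEquiv.ofBijective
    (MonoidHom.mk' (fun p => ⟨I.liftGroup x₀ p.left * I.liftAut x₀ p.right,
        (I.lift_mem_lascarStrong_iff x₀ _ _).2 ⟨p.left.2, p.right.2⟩⟩)
      fun p q => Subtype.ext (I.lift_mul_lift x₀ _ _ _ _).symm)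
    ⟨fun p q h => by
      obtain ⟨h1, h2⟩ := I.lift_inj x₀ (congrArg Subtype.val h)
      exact SemidirectProduct.ext_iff.2 ⟨Subtype.ext h1, Subtype.ext h2⟩,
    fun F => by
      obtain ⟨g, hg, f, hf, h⟩ := I.exists_eq_lift_of_mem_lascarStrong x₀ F.2
      exact ⟨⟨⟨g, hg⟩, ⟨f, hf⟩⟩, Subtype.ext h.symm⟩⟩

/-- The homomorphism `G / G_L ⋊ Gal_L(Th(M)) → Gal_L(Th(N))`. -/
noncomputable def galHom :
    (I.Carrier M ⧸ I.lascarSubgroup M) ⋊[I.galAction M] LascarGroup L M →*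
      LascarGroup I.pairLanguage (I.Pair M X) :=
  SemidirectProduct.lift
    (QuotientGroup.map _ _ (I.liftGroup x₀) fun _ => I.liftGroup_mem_lascarStrong x₀)
    (QuotientGroup.map _ _ (I.liftAut x₀) fun _ => I.liftAut_mem_lascarStrong x₀) fun f => by
      ext g
      induction f using QuotientGroup.induction_on with
      | H f =>
        exact congrArg QuotientGroup.mk (eq_mul_inv_of_mul_eq (I.liftAut_mul_liftGroup x₀ g f).symm)

theorem galHom_mk (g : I.Carrier M) (f : Aut L M) :
    I.galHom x₀ ⟨QuotientGroup.mk g, QuotientGroup.mk f⟩ =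
      QuotientGroup.mk (I.liftGroup x₀ g * I.liftAut x₀ f) := rfl

/-- The kernel is trivial by `lift_mem_lascarStrong_iff`; surjectivity is the decomposition of
`Aut(N)`. -/
theorem galHom_bijective : Function.Bijective (I.galHom (M := M) x₀) := by
  constructor
  · refine (injective_iff_map_eq_one _).2 ?_
    rintro ⟨g, f⟩ h
    induction g using QuotientGroup.induction_on
    induction f using QuotientGroup.induction_on
    rw [galHom_mk, QuotientGroup.eq_one_iff, lift_mem_lascarStrong_iff] at h
    exact SemidirectProduct.ext_iff.2
      ⟨(QuotientGroup.eq_one_iff _).2 h.1, (QuotientGroup.eq_one_iff _).2 h.2⟩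
  · intro F
    induction F using QuotientGroup.induction_on with
    | H F =>
      obtain ⟨g, f, -, -, rfl⟩ := I.exists_eq_lift x₀ F
      exact ⟨_, I.galHom_mk x₀ g f⟩

end GroupFormulas

end AffineCopy

theorem proposition3p3
    {L : FirstOrder.Language.{u, v}} (I : AffineCopy.GroupFormulas L)
    -- the structure `N = (M, X, ·)`
    {M : Type w} [L.Structure M] [I.IsGroup M]
    {X : Type w'} [MulAction (I.Carrier M) X] [AffineCopy.IsAffineCopy (I.Carrier M) X]
    -- the structure `N* = (M*, X*, ·)`, a monster model extending `N`
    {MM : Type*} [L.Structure MM] [I.IsGroup MM]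
    {XX : Type*} [MulAction (I.Carrier MM) XX] [AffineCopy.IsAffineCopy (I.Carrier MM) XX]
    (_e : I.Pair M X ↪ₑ[I.pairLanguage] I.Pair MM XX)
    (_hmonster : AffineCopy.IsMonster I.pairLanguage (I.Pair MM XX))
    (x₀ : XX) :
    -- (1) `Aut(N*) = G* ⋊ Aut(M*)`
    ((∃ Φ : I.Carrier MM ⋊[I.autAction MM] AffineCopy.Aut L MM ≃*
          AffineCopy.Aut I.pairLanguage (I.Pair MM XX),
        ∀ p, Φ p = I.liftGroup x₀ p.left * I.liftAut x₀ p.right) ∧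
      ∀ F : AffineCopy.Aut I.pairLanguage (I.Pair MM XX),
        ∃ (g : I.Carrier MM) (f : AffineCopy.Aut L MM),
          (∀ m : MM, F (I.inM m) = I.inM (f m)) ∧
          F (I.inX x₀) = I.inX (g⁻¹ • x₀) ∧
          F = I.liftGroup x₀ g * I.liftAut x₀ f) ∧
    -- (2) the automorphisms of `N*` that fix an elementary substructure `N' = (M', X')`
    (∀ N' : I.pairLanguage.ElementarySubstructure (I.Pair MM XX),
      (∃ h₀ : I.Carrier MM, I.inX (h₀ • x₀) ∈ N') ∧
      ∀ h₀ : I.Carrier MM, I.inX (h₀ • x₀) ∈ N' →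
        (∀ x : XX, I.inX x ∈ N' ↔
          ∃ g ∈ I.groupPoints (I.traceM (N' : Set (I.Pair MM XX))), x = g • h₀ • x₀) ∧
        ∀ F : AffineCopy.Aut I.pairLanguage (I.Pair MM XX),
          F ∈ AffineCopy.fixing I.pairLanguage (I.Pair MM XX) (N' : Set (I.Pair MM XX)) ↔
            ∃ f ∈ AffineCopy.fixing L MM (I.traceM (N' : Set (I.Pair MM XX))),
              F = (I.liftGroup x₀ h₀)⁻¹ * I.liftAut x₀ f * I.liftGroup x₀ h₀) ∧
    -- (3) `Autf_L(N*) = G*_L ⋊ Autf_L(M*)` and `Gal_L(Th N) = G*/G*_L ⋊ Gal_L(Th M)`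
    (∃ Ψ : I.lascarSubgroup MM ⋊[I.lascarAction MM] AffineCopy.lascarStrong L MM ≃*
          AffineCopy.lascarStrong I.pairLanguage (I.Pair MM XX),
        ∀ p, (Ψ p : AffineCopy.Aut I.pairLanguage (I.Pair MM XX)) =
          I.liftGroup x₀ p.left * I.liftAut x₀ p.right) ∧
    (∃ Γ : (I.Carrier MM ⧸ I.lascarSubgroup MM) ⋊[I.galAction MM] AffineCopy.LascarGroup L MM ≃*
          AffineCopy.LascarGroup I.pairLanguage (I.Pair MM XX),
        ∀ (g : I.Carrier MM) (f : AffineCopy.Aut L MM),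
          Γ ⟨QuotientGroup.mk g, QuotientGroup.mk f⟩ =
            QuotientGroup.mk (I.liftGroup x₀ g * I.liftAut x₀ f)) := by
  exact ⟨⟨⟨I.semidirectEquiv x₀, I.semidirectEquiv_apply x₀⟩, I.exists_eq_lift x₀⟩,
    fun N' => ⟨I.exists_smul_mem N' x₀, fun h₀ h => ⟨I.inX_mem_iff N' h, I.mem_fixing_iff N' h⟩⟩,
    ⟨I.lascarEquiv x₀, fun _ => rfl⟩,
    ⟨MulEquiv.ofBijective (I.galHom x₀) (I.galHom_bijective x₀), I.galHom_mk x₀⟩⟩
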